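/- Fix a field $k$. For a finite poset $\mathcal{P}$, let $\operatorname{mod}\mathcal{P}$ be the category of functors from $\mathcal{P}$ to finite-dimensional $k$-vector spaces ($\mathcal{P}$-modules), and let $\mathrm{K}_0^{\mathrm{sp}}(\mathcal{P})$ be its split Grothendieck group, i.e. the free abelian group on isomorphism classes $[M]$ modulo the relations $[M\oplus N]=[M]+[N]$. For an order-convex subset $S\subseteq\mathcal{P}$, let $\mathbb{I}_S$ be the module equal to $k$ on $S$ and to $0$ elsewhere, with identity maps between points of $S$. For a finite poset $\mathcal{X}$ with finitely many isomorphism classes of indecomposable modules, let $\operatorname{Ind}\mathcal{X}$ be a set of representatives of these classes, and let $\mathrm{Emb}_{\mathcal{X}}^{\mathcal{P}}$ be a set of representatives of the order-embeddings $\mathcal{X}\to\mathcal{P}$ (maps $f$ with $x\le x'\Leftrightarrow f(x)\le f(x')$) up to automorphisms of $\mathcal{X}$. For an order-embedding $f$, let $f^*:\operatorname{mod}\mathcal{P}\to\operatorname{mod}\mathcal{X}$ be the restriction functor, with left adjoint $f_!$ and right adjoint $f_*$. Let $\theta_f(U):f_!U\to f_*U$ be the morphism corresponding to $1_U$ under $\operatorname{Hom}_{\mathcal{P}}(f_!U,f_*U)\cong\operatorname{Hom}_{\mathcal{X}}(U,f^*f_*U)\cong\operatorname{End}_{\mathcal{X}}(U)$,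 and let $\Theta_f(U)=\operatorname{Im}\theta_f(U)$ be the intermediate extension. The invariant $$\mathbf{mult}_{\mathcal{X},\mathcal{P}}:\mathrm{K}_0^{\mathrm{sp}}(\mathcal{P})\to\mathbb{Z}^{\mathrm{Emb}_{\mathcal{X}}^{\mathcal{P}}\times\operatorname{Ind}\mathcal{X}}$$ is the homomorphism whose value on $[M]$ at $(f,U)$ is the multiplicity of $U$ in a decomposition of $f^*M$ into indecomposables. A basis of a homomorphism $\Psi:\mathrm{K}_0^{\mathrm{sp}}(\mathcal{P})\to\mathbb{Z}^J$ with finitely generated image is a set $\mathcal{B}$ of indecomposable $\mathcal{P}$-modules such that $\Psi$ restricts to an isomorphism from the free abelian subgroup of $\mathrm{K}_0^{\mathrm{sp}}(\mathcal{P})$ generated by the classes $[U]$, $U\in\mathcal{B}$, onto $\operatorname{Im}\Psi$. **Theorem.** Let $\mathcal{P}$ be a finite connected poset, and let $\mathcal{X}$ be one of the posets on $\{1,2,3\}$ given by $\mathcal{X}'_3$: $1<2$, $1<3$ (with $2,3$ incomparable), or $\mathcal{X}''_3$: $1<3$, $2<3$ (with $1,2$ incomparable). Assume that for all $a<b$ in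 $\mathcal{P}$ there is $f\in\mathrm{Emb}_{\mathcal{X}}^{\mathcal{P}}$ with $\{a,b\}\subseteq\operatorname{Im} f$. Then the set $$\mathcal{R}=\{\Theta_f(U)\mid f\in\mathrm{Emb}_{\mathcal{X}}^{\mathcal{P}},\ U\in\operatorname{Ind}\mathcal{X}\}$$ is a basis of $\mathbf{mult}_{\mathcal{X},\mathcal{P}}$. Moreover, if $\mathcal{P}$ has at least two elements, then a $\mathcal{P}$-module is isomorphic to a member of $\mathcal{R}$ if and only if it is simple, or isomorphic to a rectangle module $\mathbb{I}_{[a,b]}$ with $a<b$, or isomorphic to a generalized rectangle module: $\mathbb{I}_{[f(1),f(2)]\cup[f(1),f(3)]}$ with $f\in\mathrm{Emb}_{\mathcal{X}}^{\mathcal{P}}$ if $\mathcal{X}=\mathcal{X}'_3$, and $\mathbb{I}_{[f(1),f(3)]\cup[f(2),f(3)]}$ with $f\in\mathrm{Emb}_{\mathcal{X}}^{\mathcal{P}}$ if $\mathcal{X}=\mathcal{X}''_3$. -/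

import Mathlib

open CategoryTheory CategoryTheory.Limits

universe v u w

noncomputable section

namespace PosetRep

/-! ### The two three-point posets -/

/-- The poset `X'_3` with one source `one` and two sinks `two`, `three`:
the strict relations are `one < two` and `one < three`. -/
inductive XPrime : Type
  | one
  | two
  | three

/-- The poset `X''_3` with two sources `one`, `two` and one sink `three`:
the strict relations are `one < three` and `two < three`. -/
inductive XDoublePrime : Type
  | one
  | two
  | three

instance : PartialOrder XPrime where
  le x y := x = y ∨ x = .one
  lt x y := x ≠ y ∧ x = .one
  le_refl x := Or.inl rfl
  le_trans x y z hxy hyz := by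
    cases x <;> cases y <;> cases z <;> simp_all
  lt_iff_le_not_ge x y := by
    cases x <;> cases y <;> simp
  le_antisymm x y hxy hyx := by
    cases x <;> cases y <;> simp_all

instance : PartialOrder XDoublePrime where
  le x y := x = y ∨ y = .three
  lt x y := x ≠ y ∧ y = .three
  le_refl x := Or.inl rfl
  le_trans x y z hxy hyz := by
    cases x <;> cases y <;> cases z <;> simp_all
  lt_iff_le_not_ge x y := by
    cases x <;> cases y <;> simp
  le_antisymm x y hxy hyx := by
    cases x <;> cases y <;> simp_all

instance : Finite XPrime :=
  Finite.of_surjective (fun i : Fin 3 => match i with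
    | 0 => XPrime.one
    | 1 => XPrime.two
    | 2 => XPrime.three) (by
      intro x
      cases x
      exacts [⟨0, rfl⟩, ⟨1, rfl⟩, ⟨2, rfl⟩])

instance : Finite XDoublePrime :=
  Finite.of_surjective (fun i : Fin 3 => match i with
    | 0 => XDoublePrime.one
    | 1 => XDoublePrime.two
    | 2 => XDoublePrime.three) (by
      intro x
      cases x
      exacts [⟨0, rfl⟩, ⟨1, rfl⟩, ⟨2, rfl⟩])

/-! ### The split Grothendieck group and bases of invariants

These are stated for an arbitrary category `C` with zero morphisms and binary biproducts. -/

section SplitGrothendieck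

variable (C : Type u) [Category.{v} C] [HasZeroMorphisms C] [HasBinaryBiproducts C]

/-- The free abelian group on the isomorphism classes of objects of `C`. -/
abbrev FreeOnIsoClasses : Type u :=
  FreeAbelianGroup (Quotient (isIsomorphicSetoid C))

variable {C} in
/-- The generator given by the isomorphism class of `M`. -/
def isoClassGen (M : C) : FreeOnIsoClasses C :=
  FreeAbelianGroup.of (Quotient.mk (isIsomorphicSetoid C) M)

/-- The subgroup generated by the relations `[M ⊞ N] = [M] + [N]`. -/
def splitRelations : AddSubgroup (FreeOnIsoClasses C) :=
  AddSubgroup.closure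
    {x | ∃ M N : C, x = isoClassGen (M ⊞ N) - (isoClassGen M + isoClassGen N)}

/-- The split Grothendieck group `K₀ˢᵖ` of `C`. -/
abbrev K0sp : Type u := FreeOnIsoClasses C ⧸ splitRelations C

variable {C}

/-- The class `[M]` of an object in the split Grothendieck group. -/
def K0sp.cls (M : C) : K0sp C := QuotientAddGroup.mk (isoClassGen M)

/-- A homomorphism out of the split Grothendieck group is determined by its values
on the classes of objects. -/
theorem K0sp.hom_ext {A : Type w} [AddCommGroup A] {Φ Ψ : K0sp C →+ A}
    (h : ∀ M : C, Φ (K0sp.cls M) = Ψ (K0sp.cls M)) : Φ = Ψ := by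
  apply QuotientAddGroup.addMonoidHom_ext
  apply FreeAbelianGroup.lift_ext
  intro q
  induction q using Quotient.inductionOn with
  | h M => exact h M

/-- A set `B` of objects is a basis of the invariant `Ψ : K₀ˢᵖ → ℤ^J`: the invariant `Ψ` is finite
(its image is finitely generated), `B` consists of indecomposable objects, the classes of the
objects of `B` freely generate a subgroup of `K₀ˢᵖ`, and `Ψ` restricts to an isomorphism from
this subgroup onto the image of `Ψ`. -/
structure IsBasisOfInvariant {J : Type w} (Ψ : K0sp C →+ (J → ℤ)) (B : Set C) : Prop where
  finite : Ψ.range.FG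
  indecomposable : ∀ U ∈ B, Indecomposable U
  free : LinearIndependent ℤ (fun c : (K0sp.cls '' B : Set (K0sp C)) => (c : K0sp C))
  bijOn : Set.BijOn Ψ (AddSubgroup.closure (K0sp.cls '' B) : Set (K0sp C)) (Ψ.range : Set (J → ℤ))

variable (C) in
/-- `I` is a set of representatives of the isomorphism classes of indecomposable objects. -/
def IsIndRepresentatives (I : Set C) : Prop :=
  (∀ U ∈ I, Indecomposable U) ∧
    ∀ V : C, Indecomposable V → ∃! U : C, U ∈ I ∧ Nonempty (V ≅ U)

end SplitGrothendieck

/-! ### Modules over posets -/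

/-- The category of finite-dimensional `P`-modules over `k`: functors from the poset `P`
to finite-dimensional `k`-vector spaces. -/
abbrev PMod (k : Type v) [Field k] (P : Type u) [PartialOrder P] : Type (max u (v + 1)) :=
  P ⥤ FGModuleCat.{v} k

section Modules

variable (k : Type v) [Field k]

instance (P : Type u) [PartialOrder P] : HasFiniteBiproducts (PMod k P) :=
  Abelian.hasFiniteBiproducts

section Interval

variable {P : Type u} [PartialOrder P]

/-- The space of the module `𝕀_S` at `p`: all of `k` if `p ∈ S`, and zero otherwise. -/
def intervalSpace (S : Set P) (p : P) : Submodule k k where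
  carrier := {x | p ∉ S → x = 0}
  add_mem' hx hy hp := by rw [hx hp, hy hp, add_zero]
  zero_mem' _ := rfl
  smul_mem' c x hx hp := by rw [hx hp, smul_zero]

open Classical in
/-- The map of the module `𝕀_S` from the space at `p` to the space at `q`: it sends `x ∈ k` to `x`
if `q ∈ S` and to zero otherwise. -/
def intervalMap (S : Set P) (p q : P) : intervalSpace k S p →ₗ[k] intervalSpace k S q where
  toFun x := ⟨if q ∈ S then (x : k) else 0, fun hq => if_neg hq⟩
  map_add' x y := by ext; dsimp; split_ifs <;> simp
  map_smul' c x := by ext; dsimp; split_ifs <;> simp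

open Classical in
/-- For an order-convex subset `S` of `P`, the module `𝕀_S` is `k` at each point of `S` and zero
at all other points; all maps between points of `S` are identities and all other maps are zero. -/
def intervalModule (S : Set P) [hS : S.OrdConnected] : PMod k P where
  obj p := FGModuleCat.of k (intervalSpace k S p)
  map {p q} _ := FGModuleCat.ofHom (intervalMap k S p q)
  map_id p := by
    apply FGModuleCat.hom_ext
    apply LinearMap.ext
    intro x
    apply Subtype.ext
    change (if p ∈ S then (x : k) else 0) = x
    split_ifs with hp
    · rfl
    · exact (x.2 hp).symm
  map_comp {p q r} f g := by
    apply FGModuleCat.hom_ext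
    apply LinearMap.ext
    intro x
    apply Subtype.ext
    change (if r ∈ S then (x : k) else 0) = if r ∈ S then (if q ∈ S then (x : k) else 0) else 0
    split_ifs with hr hq
    · rfl
    · exact x.2 fun hp => hq (hS.out hp hr ⟨leOfHom f, leOfHom g⟩)
    · rfl

instance ordConnected_union_left (a b c : P) :
    (Set.Icc a b ∪ Set.Icc a c : Set P).OrdConnected := by
  refine ⟨?_⟩
  rintro x hx y (hy | hy) z ⟨hxz, hzy⟩
  · exact Or.inl ⟨(hx.elim (·.1) (·.1)).trans hxz, hzy.trans hy.2⟩
  · exact Or.inr ⟨(hx.elim (·.1) (·.1)).trans hxz, hzy.trans hy.2⟩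

instance ordConnected_union_right (a b c : P) :
    (Set.Icc a c ∪ Set.Icc b c : Set P).OrdConnected := by
  refine ⟨?_⟩
  rintro x (hx | hx) y hy z ⟨hxz, hzy⟩
  · exact Or.inl ⟨hx.1.trans hxz, hzy.trans (hy.elim (·.2) (·.2))⟩
  · exact Or.inr ⟨hx.1.trans hxz, hzy.trans (hy.elim (·.2) (·.2))⟩

end Interval

/-! ### Restriction along order-embeddings and the intermediate extension -/

section Embeddings

variable {X : Type w} [PartialOrder X] {P : Type u} [PartialOrder P]

/-- The functor between poset categories given by an order-embedding. -/
abbrev embFunctor (f : X ↪o P) : X ⥤ P := f.monotone.functor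

instance (f : X ↪o P) : (embFunctor f).Full where
  map_surjective g := ⟨homOfLE (f.le_iff_le.1 (leOfHom g)), rfl⟩

/-- The restriction functor `f^*`. -/
abbrev restrict (f : X ↪o P) : PMod k P ⥤ PMod k X :=
  (Functor.whiskeringLeft X P (FGModuleCat.{v} k)).obj (embFunctor f)

/-- `E` is a set of representatives of the order-embeddings `X → P` up to automorphisms of `X`. -/
def IsEmbRepresentatives (E : Set (X ↪o P)) : Prop :=
  ∀ g : X ↪o P, ∃! f : X ↪o P, f ∈ E ∧ ∃ σ : X ≃o X, ∀ x, g x = f (σ x)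

section KanExtensions

variable [Finite X]

instance (f : X ↪o P) (p : P) :
    HasColimitsOfShape (CostructuredArrow (embFunctor f) p) (FGModuleCat.{v} k) := by
  let G : {x : X // f x ≤ p} ⥤ CostructuredArrow (embFunctor f) p :=
    { obj := fun x => CostructuredArrow.mk (Y := x.1) (homOfLE x.2)
      map := fun {x y} g => CostructuredArrow.homMk (homOfLE (leOfHom g)) }
  have : G.Faithful := ⟨fun _ => Subsingleton.elim _ _⟩
  have : G.Full := ⟨fun {x y} g => ⟨homOfLE (leOfHom g.left),
    CostructuredArrow.hom_ext _ _ (Subsingleton.elim _ _)⟩⟩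
  have : G.EssSurj := ⟨fun Y => ⟨⟨Y.left, leOfHom Y.hom⟩,
    ⟨CostructuredArrow.isoMk (Iso.refl _)⟩⟩⟩
  have : G.IsEquivalence := {}
  let _ : Fintype {x : X // f x ≤ p} := Fintype.ofFinite _
  exact hasColimitsOfShape_of_equivalence G.asEquivalence

instance (f : X ↪o P) (p : P) :
    HasLimitsOfShape (StructuredArrow p (embFunctor f)) (FGModuleCat.{v} k) := by
  let G : {x : X // p ≤ f x} ⥤ StructuredArrow p (embFunctor f) :=
    { obj := fun x => StructuredArrow.mk (Y := x.1) (homOfLE x.2)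
      map := fun {x y} g => StructuredArrow.homMk (homOfLE (leOfHom g)) }
  have : G.Faithful := ⟨fun _ => Subsingleton.elim _ _⟩
  have : G.Full := ⟨fun {x y} g => ⟨homOfLE (leOfHom g.right),
    StructuredArrow.hom_ext _ _ (Subsingleton.elim _ _)⟩⟩
  have : G.EssSurj := ⟨fun Y => ⟨⟨Y.right, leOfHom Y.hom⟩,
    ⟨StructuredArrow.isoMk (Iso.refl _)⟩⟩⟩
  have : G.IsEquivalence := {}
  let _ : Fintype {x : X // p ≤ f x} := Fintype.ofFinite _
  exact hasLimitsOfShape_of_equivalence G.asEquivalence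

/-- The induction functor `f_!`, left adjoint to `f^*`. -/
abbrev induction (f : X ↪o P) : PMod k X ⥤ PMod k P := (embFunctor f).lan

/-- The coinduction functor `f_*`, right adjoint to `f^*`. -/
abbrev coinduction (f : X ↪o P) : PMod k X ⥤ PMod k P := (embFunctor f).ran

/-- The adjunction between `f_!` and `f^*`. -/
abbrev inductionAdj (f : X ↪o P) : induction k f ⊣ restrict k f :=
  (embFunctor f).lanAdjunction (FGModuleCat.{v} k)

/-- The adjunction between `f^*` and `f_*`. -/
abbrev coinductionAdj (f : X ↪o P) : restrict k f ⊣ coinduction k f :=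
  (embFunctor f).ranAdjunction (FGModuleCat.{v} k)

variable {k}

/-- The natural map `θ_f U : f_! U ⟶ f_* U` corresponding to the identity of `U` under
`Hom(f_! U, f_* U) ≅ Hom(U, f^* f_* U) ≅ Hom(U, U)`, where the second isomorphism is induced by
the counit `f^* f_* U ≅ U`. -/
def theta (f : X ↪o P) (U : PMod k X) : (induction k f).obj U ⟶ (coinduction k f).obj U :=
  ((inductionAdj k f).homEquiv U ((coinduction k f).obj U)).symm
    (inv ((coinductionAdj k f).counit.app U))

/-- The intermediate extension `Θ_f U`, the image of `θ_f U`. -/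
def Theta (f : X ↪o P) (U : PMod k X) : PMod k P := image (theta f U)

/-- The set `{Θ_f U | f ∈ E, U ∈ I}` of intermediate extensions. -/
def intermediateExtensions (E : Set (X ↪o P)) (I : Set (PMod k X)) : Set (PMod k P) :=
  {N | ∃ f ∈ E, ∃ U ∈ I, N = Theta f U}

end KanExtensions

/-! ### The multiplicity invariant -/

variable {k}

/-- The finite family `V` is a decomposition of `N` as a direct sum of indecomposables. -/
def IsDecomposition (N : PMod k X) {n : ℕ} (V : Fin n → PMod k X) : Prop :=
  (∀ i, Indecomposable (V i)) ∧ Nonempty (N ≅ ⨁ V)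

/-- `m` is the multiplicity of `U` in `N`: the module `N` has a decomposition into
indecomposables, and in every such decomposition exactly `m` summands are isomorphic to `U`. -/
def IsMultiplicity (U N : PMod k X) (m : ℕ) : Prop :=
  (∃ (n : ℕ) (V : Fin n → PMod k X), IsDecomposition N V) ∧
    ∀ (n : ℕ) (V : Fin n → PMod k X), IsDecomposition N V →
      Nat.card {i : Fin n // Nonempty (V i ≅ U)} = m

/-- `Ψ` is the multiplicity invariant `mult_{X,P}`, the homomorphism `K₀ˢᵖ(P) → ℤ^(E × I)` whose
value on `[M]` at `(f, U)` is the multiplicity of `U` in `f^* M`. -/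
def IsMultInvariant (E : Set (X ↪o P)) (I : Set (PMod k X))
    (Ψ : K0sp (PMod k P) →+ (E × I → ℤ)) : Prop :=
  ∀ (M : PMod k P) (f : E) (U : I), ∃ m : ℕ,
    IsMultiplicity U.1 ((restrict k f.1).obj M) m ∧ Ψ (K0sp.cls M) (f, U) = m

/-- There is at most one multiplicity invariant. -/
theorem IsMultInvariant.unique {E : Set (X ↪o P)} {I : Set (PMod k X)}
    {Φ Ψ : K0sp (PMod k P) →+ (E × I → ℤ)}
    (hΦ : IsMultInvariant E I Φ) (hΨ : IsMultInvariant E I Ψ) : Φ = Ψ := by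
  apply K0sp.hom_ext
  intro M
  funext ⟨f, U⟩
  obtain ⟨m, hm, h₁⟩ := hΦ M f U
  obtain ⟨m', hm', h₂⟩ := hΨ M f U
  obtain ⟨n, V, hV⟩ := hm.1
  rw [h₁, h₂, ← hm.2 n V hV, ← hm'.2 n V hV]

end Embeddings

end Modules

end PosetRep

end

open PosetRep

/-!
Let `X` be `X'₃` or `X''₃` and call `S ⊆ X` basic if it is a point, a two-element chain or all of
`X`. The indecomposable `X`-modules are the interval modules `𝕀_S` with `S` basic, and
`Θ_f 𝕀_S = 𝕀_{hull f S}`, where `hull f S` is the order-convex hull of `f(S)` in `P`: the module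
`𝕀_{hull f S}` restricts to `𝕀_S`, is generated by its values on `f(S)`, and embeds into the
coinduction of its restriction.

A basic `S` has a least element `a` if `X = X'₃`. Let `r_S(M)` be the dimension of `M_a` modulo the
kernels of all the maps `M_a ⟶ M_b` with `b ∈ S`. This is additive, and `r_S(𝕀_T)` is one if
`S ⊆ T` and zero otherwise. Hence the numbers `r_S(f^* M)` and the multiplicities in `f^* M`
determine each other by Möbius inversion. Moreover `r_S(f^* M) = r_{hull f S}(M)` depends on `f` and
`S` only through `hull f S`, so the kernel of the multiplicity invariant is cut out by the ranks
over the hulls. On the modules `𝕀_T`, `T` a hull, these ranks form the zeta matrix of the poset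
of hulls. This matrix is invertible, so the classes of the `𝕀_T` span a complement of the kernel.

For `X''₃` one takes instead the greatest element `a` of `S` and the dimension of the intersection
in `M_a` of the images of the maps `M_b ⟶ M_a` with `b ∈ S`.
-/

noncomputable section

namespace PosetRep

/-! ### Additive invariants -/

section AdditiveInvariants

variable {C : Type u} [Category.{v} C]

theorem indecomposable_of_functor {D : Type*} [Category* D] [Preadditive C] [Preadditive D]
    [HasBinaryBiproducts C] [HasBinaryBiproducts D] (F : C ⥤ D) [F.Additive] {N : C}
    (hN : Indecomposable (F.obj N)) (hF : ∀ e : N ⟶ N, F.map e = 0 → e = 0) :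
    Indecomposable N := by
  have isZero_of_retract {A : C} (h : Retract A N) (hA : IsZero (F.obj A)) : IsZero A := by
    have he : h.r ≫ h.i = 0 := hF _ (by rw [F.map_comp, hA.eq_zero_of_src (F.map h.i), comp_zero])
    rw [IsZero.iff_id_eq_zero, ← Category.id_comp (𝟙 A), ← h.retract, Category.assoc,
      reassoc_of% he, zero_comp, comp_zero]
  have := preservesBinaryBiproducts_of_preservesBiproducts F
  refine ⟨fun h => hN.1 (F.map_isZero h), fun Y Z φ => ?_⟩
  refine (hN.2 _ _ (F.mapIso φ ≪≫ F.mapBiprod Y Z)).imp (isZero_of_retract ?_)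
    (isZero_of_retract ?_)
  · exact ⟨biprod.inl ≫ φ.inv, φ.hom ≫ biprod.fst, by simp⟩
  · exact ⟨biprod.inr ≫ φ.inv, φ.hom ≫ biprod.snd, by simp⟩

theorem indecomposable_of_iso [HasZeroMorphisms C] [HasBinaryBiproducts C] {M N : C} (e : M ≅ N)
    (hN : Indecomposable N) : Indecomposable M :=
  ⟨fun hM => hN.1 (hM.of_iso e.symm), fun Y Z φ => hN.2 Y Z (e.symm ≪≫ φ)⟩

theorem nonempty_iso_biprod_of_retract [Preadditive C] [HasBinaryBiproducts C] [HasCokernels C]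
    {A N : C} (h : Retract A N) : ∃ Q : C, Nonempty (N ≅ A ⊞ Q) := by
  have : IsSplitMono h.i := ⟨⟨⟨h.r, h.retract⟩⟩⟩
  exact ⟨_, ⟨biprod.uniqueUpToIso _ _
    (isBilimitBinaryBiconeOfIsSplitMonoOfCokernel (cokernelIsCokernel h.i))⟩⟩

/-- The biproduct of `n + 1` objects as the binary biproduct of the first one and the biproduct
of the others, for arguments by induction on the number of summands. -/
def biproductFinSucc [Preadditive C] [HasFiniteBiproducts C] [HasBinaryBiproducts C] {n : ℕ}
    (V : Fin (n + 1) → C) : ⨁ V ≅ V 0 ⊞ ⨁ fun i : Fin n => V i.succ where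
  hom := biprod.lift (biproduct.π V 0) (biproduct.lift fun i => biproduct.π V i.succ)
  inv := biprod.desc (biproduct.ι V 0) (biproduct.desc fun i => biproduct.ι V i.succ)
  hom_inv_id := by
    rw [biprod.lift_desc, biproduct.lift_desc, ← biproduct.total, Fin.sum_univ_succ]
  inv_hom_id := by
    ext i j
    · simp
    · simp [biproduct.ι_π_ne _ (Fin.succ_ne_zero _).symm]
    · simp [biproduct.ι_π_ne _ (Fin.succ_ne_zero _)]
    · obtain rfl | hij := eq_or_ne i j
      · simp
      · simp [biproduct.ι_π_ne _ hij, biproduct.ι_π_ne _ ((Fin.succ_injective _).ne hij)]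

/-- A function on objects that is invariant under isomorphism and additive on biproducts. Such
functions with values in a group are the homomorphisms out of the split Grothendieck group. -/
structure IsAdditiveInvariant [HasZeroMorphisms C] [HasBinaryBiproducts C] {A : Type*}
    [AddCommMonoid A] (r : C → A) : Prop where
  iso {M N : C} (e : M ≅ N) : r M = r N
  biprod (M N : C) : r (M ⊞ N) = r M + r N

namespace IsAdditiveInvariant

theorem of_isZero [HasZeroMorphisms C] [HasBinaryBiproducts C] {A : Type*}
    [AddCancelCommMonoid A] {r : C → A} (h : IsAdditiveInvariant r) {Z : C} (hZ : IsZero Z) :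
    r Z = 0 := by
  have e : Z ⊞ Z ≅ Z := ((biprod_isZero_iff Z Z).2 ⟨hZ, hZ⟩).iso hZ
  exact left_eq_add.1 ((h.iso e).symm.trans (h.biprod Z Z))

theorem biproduct [Preadditive C] [HasBinaryBiproducts C] [HasFiniteBiproducts C] {A : Type*}
    [AddCancelCommMonoid A] {r : C → A} (h : IsAdditiveInvariant r) {n : ℕ} (V : Fin n → C) :
    r (⨁ V) = ∑ i, r (V i) := by
  induction n with
  | zero =>
    refine (h.of_isZero ((IsZero.iff_id_eq_zero _).2 ?_)).trans (Fin.sum_univ_zero _).symm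
    exact biproduct.hom_ext _ _ fun i => i.elim0
  | succ n ih => rw [h.iso (biproductFinSucc V), h.biprod, ih, Fin.sum_univ_succ]

theorem comp_addMonoidHom [HasZeroMorphisms C] [HasBinaryBiproducts C] {A B : Type*}
    [AddCommMonoid A] [AddCommMonoid B] {r : C → A} (h : IsAdditiveInvariant r) (φ : A →+ B) :
    IsAdditiveInvariant fun M => φ (r M) where
  iso e := congrArg φ (h.iso e)
  biprod M N := by rw [h.biprod, map_add]

theorem pi [HasZeroMorphisms C] [HasBinaryBiproducts C] {ι A : Type*} [AddCommMonoid A]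
    {r : ι → C → A} (h : ∀ i, IsAdditiveInvariant (r i)) :
    IsAdditiveInvariant fun M i => r i M where
  iso e := funext fun i => (h i).iso e
  biprod M N := funext fun i => (h i).biprod M N

theorem comp_functor [Preadditive C] [HasBinaryBiproducts C] {D : Type*} [Category D]
    [Preadditive D] [HasBinaryBiproducts D] {A : Type*} [AddCommMonoid A] {r : D → A}
    (h : IsAdditiveInvariant r) (F : C ⥤ D) [F.Additive] :
    IsAdditiveInvariant fun M => r (F.obj M) where
  iso e := h.iso (F.mapIso e)
  biprod M N := by
    have := preservesBinaryBiproducts_of_preservesBiproducts F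
    rw [h.iso (F.mapBiprod M N), h.biprod]

end IsAdditiveInvariant

theorem isAdditiveInvariant_finrank (k : Type v) [Field k] :
    IsAdditiveInvariant fun V : FGModuleCat.{v} k => Module.finrank k V := by
  have h : IsAdditiveInvariant fun V : ModuleCat.{v} k => Module.rank k V :=
    ⟨fun e => e.toLinearEquiv.rank_eq,
      fun V W => (ModuleCat.biprodIsoProd V W).toLinearEquiv.rank_eq.trans (rank_prod' ..)⟩
  have h' := h.comp_functor (forget₂ (FGModuleCat.{v} k) (ModuleCat.{v} k))
  refine ⟨fun e => congrArg Cardinal.toNat (h'.iso e), fun V W => ?_⟩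
  exact (congrArg Cardinal.toNat (h'.biprod V W)).trans
    (Cardinal.toNat_add (Module.rank_lt_aleph0 k V) (Module.rank_lt_aleph0 k W))

theorem indecomposable_of_finrank_eq_one {k : Type v} [Field k] {V : FGModuleCat.{v} k}
    (hV : Module.finrank k V = 1) : Indecomposable V := by
  have hd := isAdditiveInvariant_finrank k
  have isZero_of_finrank {W : FGModuleCat.{v} k} (hW : Module.finrank k W = 0) : IsZero W := by
    have := Module.finrank_zero_iff.1 hW
    exact (IsZero.iff_id_eq_zero W).2
      (FGModuleCat.hom_ext (LinearMap.ext fun x => Subsingleton.elim _ _))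
  refine ⟨fun h => one_ne_zero (hV.symm.trans (hd.of_isZero h)), fun Y Z φ => ?_⟩
  have hYZ := (hd.biprod Y Z).symm.trans ((hd.iso φ).symm.trans hV)
  have : Module.finrank k Y = 0 ∨ Module.finrank k Z = 0 := by omega
  exact this.imp isZero_of_finrank isZero_of_finrank

section SplitGrothendieck

variable [HasZeroMorphisms C] [HasBinaryBiproducts C] {A : Type*} [AddCommGroup A]

/-- The homomorphism on the split Grothendieck group given by an additive invariant. -/
def K0sp.lift (r : C → A) (h : IsAdditiveInvariant r) : K0sp C →+ A :=
  QuotientAddGroup.lift (splitRelations C)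
    (FreeAbelianGroup.lift (Quotient.lift r fun _ _ ⟨e⟩ => h.iso e)) (by
      rw [splitRelations, AddSubgroup.closure_le]
      rintro _ ⟨M, N, rfl⟩
      simp [isoClassGen, h.biprod])

theorem K0sp.lift_cls (r : C → A) (h : IsAdditiveInvariant r) (M : C) :
    K0sp.lift r h (K0sp.cls M) = r M :=
  FreeAbelianGroup.lift_apply_of _ _

theorem K0sp.cls_eq_of_iso {M N : C} (e : M ≅ N) : K0sp.cls M = K0sp.cls N :=
  congrArg (fun q => QuotientAddGroup.mk (FreeAbelianGroup.of q))
    (Quotient.sound (s := isIsomorphicSetoid C) ⟨e⟩)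

theorem IsBasisOfInvariant.of_isCompl {J : Type*} {Ψ : K0sp C →+ (J → ℤ)} {B : Set C}
    (hfin : (K0sp.cls '' B).Finite) (hind : ∀ U ∈ B, Indecomposable U)
    (hli : LinearIndepOn ℤ id (K0sp.cls '' B))
    (hΨ : IsCompl (Submodule.span ℤ (K0sp.cls '' B)) (LinearMap.ker Ψ.toIntLinearMap)) :
    IsBasisOfInvariant Ψ B := by
  have hspan : ((Submodule.span ℤ (K0sp.cls '' B) : Submodule ℤ (K0sp C)) : Set (K0sp C)) =
      AddSubgroup.closure (K0sp.cls '' B) := by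
    rw [← Submodule.span_int_eq_addSubgroupClosure, Submodule.coe_toAddSubgroup]
  have hinj : Set.InjOn Ψ (AddSubgroup.closure (K0sp.cls '' B)) := by
    rw [← hspan]
    exact LinearMap.disjoint_ker_iff_injOn.1 hΨ.disjoint
  have himage : (AddSubgroup.closure (K0sp.cls '' B)).map Ψ = Ψ.range := by
    refine le_antisymm (by rintro _ ⟨x, -, rfl⟩; exact ⟨x, rfl⟩) ?_
    rintro _ ⟨x, rfl⟩
    obtain ⟨y, hy, z, hz, rfl⟩ := Submodule.mem_sup.1 (hΨ.sup_eq_top ▸ Submodule.mem_top (x := x))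
    have hz' : Ψ z = 0 := hz
    exact ⟨y, hspan.le hy, by rw [map_add, hz', add_zero]⟩
  refine ⟨?_, hind, hli, fun x _ => ⟨x, rfl⟩, hinj, (congrArg SetLike.coe himage).ge⟩
  rw [← himage, AddMonoidHom.map_closure]
  exact (AddSubgroup.fg_iff _).2 ⟨_, rfl, hfin.image Ψ⟩

end SplitGrothendieck

end AdditiveInvariants

section Zeta

variable (R T : Type*) [CommRing R] [PartialOrder T]

open Classical in
theorem isUnit_det_zeta [Fintype T] :
    IsUnit (Matrix.of fun s t : T => if s ≤ t then (1 : R) else 0).det := by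
  let e : LinearExtension T ≃ T := Equiv.refl T
  have : Fintype (LinearExtension T) := ‹Fintype T›
  rw [← Matrix.det_submatrix_equiv_self e, Matrix.det_of_isUpperTriangular]
  · simp
  · intro i j hij
    exact if_neg fun h : e i ≤ e j => absurd (toLinearExtension.monotone h) (not_le.2 hij)

open Classical in
/-- The zeta transform `c ↦ (s ↦ ∑ t ≥ s, c t)` of a finite poset; its inverse is Möbius
inversion. -/
def zetaEquiv [Fintype T] : (T → R) ≃ₗ[R] (T → R) :=
  Matrix.toLinearEquiv' _ (Matrix.invertibleOfIsUnitDet _ (isUnit_det_zeta R T))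

variable {R T}

open Classical in
theorem zetaEquiv_apply [Fintype T] (c : T → R) (s : T) :
    zetaEquiv R T c s = ∑ t, if s ≤ t then c t else 0 := by
  change Matrix.mulVec _ c s = _
  simp [Matrix.mulVec, dotProduct]

variable {M : Type*} [AddCommGroup M] [Module R M] {e : T → M} {μ : M →ₗ[R] (T → R)}

open Classical in
theorem comp_linearCombination_eq_zetaEquiv [Fintype T]
    (h : ∀ s t, μ (e t) s = if s ≤ t then 1 else 0) :
    μ ∘ₗ Fintype.linearCombination R e = zetaEquiv R T := by
  refine LinearMap.ext fun c => funext fun s => ?_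
  simp [Fintype.linearCombination_apply, zetaEquiv_apply, h]

open Classical in
theorem linearIndependent_of_eq_zeta [Finite T]
    (h : ∀ s t, μ (e t) s = if s ≤ t then 1 else 0) : LinearIndependent R e := by
  have := Fintype.ofFinite T
  rw [linearIndependent_iff_injective_fintypeLinearCombination]
  refine .of_comp (f := μ) ?_
  rw [← LinearMap.coe_comp, comp_linearCombination_eq_zetaEquiv h]
  exact (zetaEquiv R T).injective

open Classical in
theorem isCompl_span_ker_of_eq_zeta [Finite T]
    (h : ∀ s t, μ (e t) s = if s ≤ t then 1 else 0) :
    IsCompl (Submodule.span R (Set.range e)) (LinearMap.ker μ) := by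
  have := Fintype.ofFinite T
  let z := zetaEquiv R T
  have hz (x : T → R) : μ (Fintype.linearCombination R e x) = z x :=
    LinearMap.congr_fun (comp_linearCombination_eq_zetaEquiv h) x
  rw [← Fintype.range_linearCombination]
  refine ⟨Submodule.disjoint_def.2 ?_, codisjoint_iff.2 (Submodule.eq_top_iff'.2 fun x => ?_)⟩
  · rintro _ ⟨c, rfl⟩ hc
    rw [LinearMap.mem_ker, hz, z.map_eq_zero_iff] at hc
    rw [hc, map_zero]
  · refine Submodule.mem_sup.2 ⟨_, ⟨z.symm (μ x), rfl⟩, _, ?_, add_sub_cancel _ x⟩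
    rw [LinearMap.mem_ker, map_sub, hz, z.apply_symm_apply, sub_self]

end Zeta

section Elementwise

variable {k : Type v} [Field k] {Q : Type u} [PartialOrder Q] {M N : PMod k Q} {a b c : Q}

/-- The structure map of a module along a relation `a ≤ b`. -/
def transition (M : PMod k Q) (h : a ≤ b) : M.obj a →ₗ[k] M.obj b :=
  (M.map (homOfLE h)).hom.hom

/-- The component at a point of a morphism of modules, as a linear map. -/
def component (φ : M ⟶ N) (a : Q) : M.obj a →ₗ[k] N.obj a :=
  (φ.app a).hom.hom

theorem transition_self (M : PMod k Q) (h : a ≤ a) : transition M h = LinearMap.id :=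
  congrArg (fun φ : M.obj a ⟶ M.obj a => φ.hom.hom) (M.map_id a)

theorem transition_comp_transition (M : PMod k Q) (h : a ≤ b) (h' : b ≤ c) :
    transition M h' ∘ₗ transition M h = transition M (h.trans h') :=
  congrArg (fun φ : M.obj a ⟶ M.obj c => φ.hom.hom) (M.map_comp (homOfLE h) (homOfLE h')).symm

theorem transition_transition (M : PMod k Q) (h : a ≤ b) (h' : b ≤ c) (x : M.obj a) :
    transition M h' (transition M h x) = transition M (h.trans h') x :=
  LinearMap.congr_fun (transition_comp_transition M h h') x

theorem component_transition (φ : M ⟶ N) (h : a ≤ b) (x : M.obj a) :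
    component φ b (transition M h x) = transition N h (component φ a x) :=
  congrArg (fun ψ : M.obj a ⟶ N.obj b => ψ.hom.hom x) (φ.naturality (homOfLE h))

theorem component_comp {L : PMod k Q} (φ : L ⟶ M) (ψ : M ⟶ N) (x : L.obj a) :
    component (φ ≫ ψ) a x = component ψ a (component φ a x) := rfl

theorem component_id (x : M.obj a) : component (𝟙 M) a x = x := rfl

theorem component_zero (x : M.obj a) : component (0 : M ⟶ N) a x = 0 := rfl

theorem hom_ext_component {φ ψ : M ⟶ N} (h : ∀ a, component φ a = component ψ a) : φ = ψ :=
  NatTrans.ext (funext fun a => FGModuleCat.hom_ext (h a))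

theorem isZero_iff_forall : IsZero M ↔ ∀ a (x : M.obj a), x = 0 := by
  rw [IsZero.iff_id_eq_zero]
  refine ⟨fun h a x => ?_, fun h => hom_ext_component fun a => LinearMap.ext fun x => ?_⟩
  · rw [← component_id x, h, component_zero]
  · exact (h a _).trans (h a _).symm

/-- The morphism of modules with given components. -/
def homOfComponents (φ : ∀ a, M.obj a →ₗ[k] N.obj a)
    (hφ : ∀ {a b : Q} (h : a ≤ b) (x : M.obj a), φ b (transition M h x) = transition N h (φ a x)) :
    M ⟶ N where
  app a := ConcreteCategory.ofHom (C := FGModuleCat.{v} k) (φ a)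
  naturality _ _ h := FGModuleCat.hom_ext (LinearMap.ext (hφ (leOfHom h)))

/-- The isomorphism of modules with given components. -/
def isoOfComponents (φ : ∀ a, M.obj a ≃ₗ[k] N.obj a)
    (hφ : ∀ {a b : Q} (h : a ≤ b) (x : M.obj a), φ b (transition M h x) = transition N h (φ a x)) :
    M ≅ N :=
  NatIso.ofComponents (fun a => (φ a).toFGModuleCatIso) fun h =>
    FGModuleCat.hom_ext (LinearMap.ext (hφ (leOfHom h)))

theorem isAdditiveInvariant_dim (a : Q) :
    IsAdditiveInvariant fun M : PMod k Q => Module.finrank k (M.obj a) :=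
  (isAdditiveInvariant_finrank k).comp_functor ((evaluation Q (FGModuleCat.{v} k)).obj a)

theorem isAdditiveInvariant_totalDim [Fintype Q] :
    IsAdditiveInvariant fun M : PMod k Q => ∑ a, Module.finrank k (M.obj a) where
  iso e := Finset.sum_congr rfl fun a _ => (isAdditiveInvariant_dim a).iso e
  biprod M N := by simp only [(isAdditiveInvariant_dim _).biprod, Finset.sum_add_distrib]

theorem totalDim_pos [Fintype Q] (hM : ¬IsZero M) : 0 < ∑ a, Module.finrank k (M.obj a) := by
  obtain ⟨a, x, hx⟩ : ∃ a, ∃ x : M.obj a, x ≠ 0 := by simpa [isZero_iff_forall] using hM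
  have : 0 < Module.finrank k (M.obj a) := Module.finrank_pos_iff_exists_ne_zero.2 ⟨x, hx⟩
  exact Finset.sum_pos' (fun _ _ => Nat.zero_le _) ⟨a, Finset.mem_univ a, this⟩

end Elementwise

/-! ### Interval modules -/

section IntervalModules

variable {k : Type v} [Field k] {Q : Type u} [PartialOrder Q] {N : PMod k Q}
  {S T : Set Q} [S.OrdConnected] [T.OrdConnected] {a b : Q}

/-- The element of `𝕀_S` at a point of `S` with the given coordinate. -/
def intervalElt (ha : a ∈ S) (c : k) : (intervalModule k S).obj a :=
  (⟨c, fun h => absurd ha h⟩ : intervalSpace k S a)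

/-- The coordinate of an element of `𝕀_S`. -/
def intervalCoord (S : Set Q) [S.OrdConnected] (a : Q) : (intervalModule k S).obj a →ₗ[k] k :=
  (intervalSpace k S a).subtype

theorem intervalCoord_injective : Function.Injective (intervalCoord (k := k) S a) :=
  Subtype.val_injective

theorem intervalCoord_intervalElt (ha : a ∈ S) (c : k) :
    intervalCoord S a (intervalElt ha c) = c := rfl

theorem eq_smul_intervalElt (ha : a ∈ S) (x : (intervalModule k S).obj a) :
    x = intervalCoord S a x • intervalElt ha (1 : k) :=
  intervalCoord_injective (by rw [map_smul, intervalCoord_intervalElt, smul_eq_mul, mul_one])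

theorem interval_eq_zero (ha : a ∉ S) (x : (intervalModule k S).obj a) : x = 0 :=
  Subtype.ext (x.2 ha)

theorem intervalCoord_transition (h : a ≤ b) (hb : b ∈ S) (x : (intervalModule k S).obj a) :
    intervalCoord S b (transition (intervalModule k S) h x) = intervalCoord S a x :=
  if_pos hb

theorem transition_intervalElt (h : a ≤ b) (ha : a ∈ S) (hb : b ∈ S) (c : k) :
    transition (intervalModule k S) h (intervalElt ha c) = intervalElt hb c :=
  intervalCoord_injective (intervalCoord_transition h hb _)

theorem finrank_interval (ha : a ∈ S) : Module.finrank k ((intervalModule k S).obj a) = 1 := by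
  have e : (intervalModule k S).obj a ≃ₗ[k] k :=
    .ofBijective (intervalCoord S a) ⟨intervalCoord_injective, fun c => ⟨intervalElt ha c, rfl⟩⟩
  rw [e.finrank_eq, Module.finrank_self]

theorem finrank_interval_eq_zero (ha : a ∉ S) :
    Module.finrank k ((intervalModule k S).obj a) = 0 :=
  have : Subsingleton ((intervalModule k S).obj a) :=
    subsingleton_of_forall_eq 0 (interval_eq_zero ha)
  Module.finrank_zero_of_subsingleton

theorem not_isZero_interval (ha : a ∈ S) : ¬IsZero (intervalModule k S) := fun h =>
  one_ne_zero ((finrank_interval ha).symm.trans ((isAdditiveInvariant_dim a).of_isZero h))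

theorem nonempty_interval_iso_iff :
    Nonempty (intervalModule k S ≅ intervalModule k T) ↔ S = T := by
  classical
  refine ⟨fun ⟨e⟩ => Set.ext fun a => ?_, ?_⟩
  · have h := (isAdditiveInvariant_dim a).iso e
    by_cases hS : a ∈ S <;> by_cases hT : a ∈ T <;>
      simp_all [finrank_interval, finrank_interval_eq_zero]
  · rintro rfl
    exact ⟨Iso.refl _⟩

/-- The restriction of an interval module along an order-embedding is an interval module. -/
def restrictInterval {X : Type w} [PartialOrder X] (f : X ↪o Q) {T : Set X} [T.OrdConnected]
    (h : f ⁻¹' S = T) : (restrict k f).obj (intervalModule k S) ≅ intervalModule k T :=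
  isoOfComponents
    (fun a => LinearEquiv.ofEq (intervalSpace k S (f a)) (intervalSpace k T a) (by
      subst h; rfl)) fun {a b} hab x => by
    subst h
    rfl

theorem interval_hom_ext {φ ψ : intervalModule k S ⟶ N} (h : ∀ a (ha : a ∈ S),
    component φ a (intervalElt ha 1) = component ψ a (intervalElt ha 1)) : φ = ψ := by
  refine hom_ext_component fun a => LinearMap.ext fun x => ?_
  by_cases ha : a ∈ S
  · rw [eq_smul_intervalElt ha x, map_smul, map_smul, h a ha]
  · rw [interval_eq_zero ha x, map_zero, map_zero]

theorem interval_hom_ext_of_coinitial {A : Set Q} (hA : ∀ p ∈ S, ∃ a ∈ A, a ∈ S ∧ a ≤ p)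
    {φ ψ : intervalModule k S ⟶ N} (h : ∀ a ∈ A, component φ a = component ψ a) : φ = ψ := by
  refine interval_hom_ext fun p hp => ?_
  obtain ⟨a, haA, haS, hap⟩ := hA p hp
  rw [← transition_intervalElt hap haS hp, component_transition, component_transition, h a haA]

theorem interval_hom_ext_of_cofinal {A : Set Q} (hA : ∀ p ∈ S, ∃ a ∈ A, a ∈ S ∧ p ≤ a)
    {φ ψ : N ⟶ intervalModule k S} (h : ∀ a ∈ A, component φ a = component ψ a) : φ = ψ := by
  refine hom_ext_component fun p => LinearMap.ext fun x => ?_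
  by_cases hp : p ∈ S
  · obtain ⟨a, haA, haS, hpa⟩ := hA p hp
    apply intervalCoord_injective
    rw [← intervalCoord_transition hpa haS, ← intervalCoord_transition hpa haS,
      ← component_transition, ← component_transition, h a haA]
  · rw [interval_eq_zero hp (component φ p x), interval_eq_zero hp (component ψ p x)]

theorem interval_hom_ext_of_isLeast (ha : IsLeast S a) {φ ψ : intervalModule k S ⟶ N}
    (h : component φ a = component ψ a) : φ = ψ :=
  interval_hom_ext_of_coinitial (A := {a}) (fun _ hp => ⟨a, rfl, ha.1, ha.2 hp⟩)
    fun _ hb => hb ▸ h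

theorem interval_hom_ext_of_isGreatest (ha : IsGreatest S a) {φ ψ : N ⟶ intervalModule k S}
    (h : component φ a = component ψ a) : φ = ψ :=
  interval_hom_ext_of_cofinal (A := {a}) (fun _ hp => ⟨a, rfl, ha.1, ha.2 hp⟩)
    fun _ hb => hb ▸ h

theorem indecomposable_interval_of_isLeast (ha : IsLeast S a) :
    Indecomposable (intervalModule k S) :=
  indecomposable_of_functor ((evaluation Q (FGModuleCat.{v} k)).obj a)
    (indecomposable_of_finrank_eq_one (finrank_interval ha.1)) fun _ he =>
      interval_hom_ext_of_isLeast ha (congrArg (fun φ => φ.hom.hom) he)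

theorem indecomposable_interval_of_isGreatest (ha : IsGreatest S a) :
    Indecomposable (intervalModule k S) :=
  indecomposable_of_functor ((evaluation Q (FGModuleCat.{v} k)).obj a)
    (indecomposable_of_finrank_eq_one (finrank_interval ha.1)) fun _ he =>
      interval_hom_ext_of_isGreatest ha (congrArg (fun φ => φ.hom.hom) he)

/-- The morphism from an interval module given by a compatible family of elements. -/
def homOfInterval (S : Set Q) [S.OrdConnected] (v : ∀ a, N.obj a)
    (hv : ∀ {a b : Q} (h : a ≤ b), a ∈ S → transition N h (v a) = v b)
    (hv0 : ∀ {a : Q}, a ∉ S → v a = 0) : intervalModule k S ⟶ N :=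
  homOfComponents (fun a => (intervalCoord S a).smulRight (v a)) fun {a b} h x => by
    simp only [LinearMap.smulRight_apply, map_smul]
    by_cases ha : a ∈ S
    · by_cases hb : b ∈ S
      · rw [intervalCoord_transition h hb, hv h ha]
      · rw [hv h ha, hv0 hb, smul_zero, smul_zero]
    · rw [interval_eq_zero ha x, map_zero, map_zero, map_zero, zero_smul, zero_smul]

/-- The morphism to an interval module given by a compatible family of functionals. -/
def homToInterval (S : Set Q) [S.OrdConnected] (φ : ∀ a, N.obj a →ₗ[k] k)
    (hφ : ∀ {a b : Q} (h : a ≤ b), b ∈ S → φ b ∘ₗ transition N h = φ a)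
    (hφ0 : ∀ {a : Q}, a ∉ S → φ a = 0) : N ⟶ intervalModule k S :=
  homOfComponents (fun a => LinearMap.codRestrict (intervalSpace k S a) (φ a)
      fun x ha => by rw [hφ0 ha, LinearMap.zero_apply]) fun {a b} h x => by
    by_cases hb : b ∈ S
    · apply intervalCoord_injective
      rw [intervalCoord_transition h hb]
      exact LinearMap.congr_fun (hφ h hb) x
    · exact (interval_eq_zero hb _).trans (interval_eq_zero hb _).symm

theorem component_homOfInterval {v : ∀ a, N.obj a}
    {hv : ∀ {a b : Q} (h : a ≤ b), a ∈ S → transition N h (v a) = v b}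
    {hv0 : ∀ {a : Q}, a ∉ S → v a = 0} (ha : a ∈ S) :
    component (homOfInterval S v hv hv0) a (intervalElt ha (1 : k)) = v a :=
  one_smul k (v a)

theorem exists_hom_of_isLeast (ha : IsLeast S a) (x : N.obj a)
    (hx : ∀ b (h : a ≤ b), b ∉ S → transition N h x = 0) :
    ∃ φ : intervalModule k S ⟶ N, component φ a (intervalElt ha.1 1) = x := by
  classical
  let v (b : Q) : N.obj b := if h : a ≤ b then transition N h x else 0
  refine ⟨homOfInterval S v (fun {b c} h hb => ?_) fun {b} hb => ?_, ?_⟩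
  · simp only [v, dif_pos (ha.2 hb), dif_pos ((ha.2 hb).trans h), transition_transition]
  · by_cases h : a ≤ b
    · exact (dif_pos h).trans (hx b h hb)
    · exact dif_neg h
  · rw [component_homOfInterval ha.1]
    exact (dif_pos le_rfl).trans (by rw [transition_self, LinearMap.id_apply])

theorem exists_hom_of_isGreatest (ha : IsGreatest S a) (ξ : N.obj a →ₗ[k] k)
    (hξ : ∀ b (h : b ≤ a), b ∉ S → ξ ∘ₗ transition N h = 0) :
    ∃ φ : N ⟶ intervalModule k S, intervalCoord S a ∘ₗ component φ a = ξ := by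
  classical
  let η (b : Q) : N.obj b →ₗ[k] k := if h : b ≤ a then ξ ∘ₗ transition N h else 0
  refine ⟨homToInterval S η (fun {b c} h hc => ?_) fun {b} hb => ?_, ?_⟩
  · simp only [η, dif_pos (ha.2 hc), dif_pos (h.trans (ha.2 hc)), LinearMap.comp_assoc,
      transition_comp_transition]
  · by_cases h : b ≤ a
    · exact (dif_pos h).trans (hξ b h hb)
    · exact dif_neg h
  · change η a = ξ
    rw [show η a = ξ ∘ₗ transition N le_rfl from dif_pos le_rfl, transition_self,
      LinearMap.comp_id]

end IntervalModules

section Simple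

variable {k : Type v} [Field k] {Q : Type u} [PartialOrder Q]

theorem simple_interval_singleton (p : Q) : Simple (intervalModule k ({p} : Set Q)) where
  mono_isIso_iff_nonzero {Y} φ _ := by
    refine ⟨fun _ h0 => not_isZero_interval (k := k) (Set.mem_singleton p) ?_, fun h0 => ?_⟩
    · exact (IsZero.iff_id_eq_zero _).2 ((IsIso.inv_hom_id φ).symm.trans (by simp [h0]))
    · have hp : intervalCoord {p} p ∘ₗ component φ p ≠ 0 := fun h => h0 <|
        interval_hom_ext_of_isGreatest isGreatest_singleton <| LinearMap.ext fun y =>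
          intervalCoord_injective (LinearMap.congr_fun h y)
      obtain ⟨y, hy⟩ := LinearMap.surjective hp 1
      have hy' : component φ p y = intervalElt (Set.mem_singleton p) 1 :=
        intervalCoord_injective hy
      have : Epi φ := ⟨fun χ ψ h => interval_hom_ext fun q hq => by
        obtain rfl := Set.mem_singleton_iff.1 hq
        rw [← hy', ← component_comp, h, component_comp]⟩
      exact isIso_of_mono_of_epi φ

theorem simple_iff_exists_iso_interval {N : PMod k Q} :
    Simple N ↔ ∃ p : Q, Nonempty (N ≅ intervalModule k ({p} : Set Q)) := by
  constructor
  · intro hN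
    obtain ⟨p, x, hx⟩ : ∃ p, ∃ x : N.obj p, x ≠ 0 := by
      by_contra! h
      exact Simple.not_isZero N (isZero_iff_forall.2 h)
    -- `N` embeds into the injective module `𝕀_{≤ p}`, which vanishes at `q`.
    have eq_zero {q : Q} (hpq : p < q) (y : N.obj q) : y = 0 := by
      obtain ⟨ξ, hξ⟩ := Module.Projective.exists_dual_ne_zero k hx
      obtain ⟨ψ, hψ⟩ := exists_hom_of_isGreatest (S := Set.Iic p) isGreatest_Iic ξ
        fun b h hb => absurd h hb
      have : Mono ψ := mono_of_nonzero_from_simple fun h0 => hξ <| by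
        rw [← hψ, h0, LinearMap.comp_apply, component_zero, map_zero]
      obtain ⟨φ, hφ⟩ := exists_hom_of_isLeast (S := Set.Ici q) isLeast_Ici y
        fun b h hb => absurd h hb
      have : φ ≫ ψ = 0 := interval_hom_ext_of_isLeast isLeast_Ici <| LinearMap.ext fun z =>
        interval_eq_zero (S := Set.Iic p) hpq.not_ge _
      rw [← hφ, zero_of_comp_mono ψ this, component_zero]
    obtain ⟨φ, hφ⟩ := exists_hom_of_isLeast (S := {p}) isLeast_singleton x
      fun b h hb => eq_zero (h.lt_of_ne (Ne.symm hb)) _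
    have := simple_interval_singleton (k := k) p
    have := isIso_of_hom_simple (f := φ) fun h0 => hx (by rw [← hφ, h0, component_zero])
    exact ⟨p, ⟨(asIso φ).symm⟩⟩
  · rintro ⟨p, ⟨e⟩⟩
    have := simple_interval_singleton (k := k) p
    exact Simple.of_iso e

end Simple

/-! ### Intermediate extensions -/

section IntermediateExtension

variable {k : Type v} [Field k] {Q : Type u} [PartialOrder Q] {X : Type w} [PartialOrder X]

instance (f : X ↪o Q) : (restrict k f).Additive where

theorem nonempty_iso_Theta [Finite X] {f : X ↪o Q} {U : PMod k X} {N : PMod k Q}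
    (e : U ≅ (restrict k f).obj N)
    (hout : ∀ (Z : PMod k Q) (φ ψ : N ⟶ Z),
      (restrict k f).map φ = (restrict k f).map ψ → φ = ψ)
    (hin : ∀ (Z : PMod k Q) (φ ψ : Z ⟶ N),
      (restrict k f).map φ = (restrict k f).map ψ → φ = ψ) :
    Nonempty (N ≅ Theta f U) := by
  let p : (induction k f).obj U ⟶ N := ((inductionAdj k f).homEquiv U N).symm e.hom
  let m : N ⟶ (coinduction k f).obj U := (coinductionAdj k f).homEquiv N U e.inv
  have hp : (inductionAdj k f).homEquiv U N p = e.hom := Equiv.apply_symm_apply _ _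
  have hm : ((coinductionAdj k f).homEquiv N U).symm m = e.inv := Equiv.symm_apply_apply _ _
  have : Epi p := ⟨fun φ ψ h => by
    apply hout
    rw [← cancel_epi e.hom, ← hp, ← Adjunction.homEquiv_naturality_right,
      ← Adjunction.homEquiv_naturality_right, h]⟩
  have : Mono m := ⟨fun φ ψ h => by
    apply hin
    rw [← cancel_mono e.inv, ← hm, ← Adjunction.homEquiv_naturality_left_symm,
      ← Adjunction.homEquiv_naturality_left_symm, h]⟩
  have hm' : (restrict k f).map m ≫ (coinductionAdj k f).counit.app U = e.inv :=
    ((coinductionAdj k f).homEquiv_counit _ _ m).symm.trans hm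
  have comm : p ≫ m = theta f U := by
    rw [theta, ← Adjunction.homEquiv_naturality_right_symm]
    congr 1
    rw [← cancel_mono ((coinductionAdj k f).counit.app U), IsIso.inv_hom_id, Category.assoc, hm',
      e.hom_inv_id]
  have : StrongEpi p := strongEpi_of_epi p
  exact ⟨image.isoStrongEpiMono p m comm⟩

/-- The order-convex hull of the image of a subset under an order-embedding. -/
def hull (f : X ↪o Q) (S : Set X) : Set Q := {p | ∃ s ∈ S, ∃ t ∈ S, f s ≤ p ∧ p ≤ f t}

instance (f : X ↪o Q) (S : Set X) : (hull f S).OrdConnected where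
  out' := by
    rintro x ⟨s, hs, _, _, hsx, _⟩ y ⟨_, _, t, ht, _, hyt⟩ z ⟨hxz, hzy⟩
    exact ⟨s, hs, t, ht, hsx.trans hxz, hzy.trans hyt⟩

theorem map_mem_hull (f : X ↪o Q) {S : Set X} {s : X} (hs : s ∈ S) : f s ∈ hull f S :=
  ⟨s, hs, s, hs, le_rfl, le_rfl⟩

theorem preimage_hull (f : X ↪o Q) (S : Set X) [hS : S.OrdConnected] : f ⁻¹' hull f S = S := by
  refine Set.Subset.antisymm ?_ fun x => map_mem_hull f
  rintro x ⟨s, hs, t, ht, hsx, hxt⟩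
  exact hS.out hs ht ⟨f.le_iff_le.1 hsx, f.le_iff_le.1 hxt⟩

theorem hull_subset_iff {f : X ↪o Q} {S : Set X} {T : Set Q} [hT : T.OrdConnected] :
    hull f S ⊆ T ↔ S ⊆ f ⁻¹' T := by
  refine ⟨fun h s hs => h (map_mem_hull f hs), ?_⟩
  rintro h p ⟨s, hs, t, ht, hsp, hpt⟩
  exact hT.out (h hs) (h ht) ⟨hsp, hpt⟩

theorem isLeast_hull (f : X ↪o Q) {S : Set X} {a : X} (ha : IsLeast S a) :
    IsLeast (hull f S) (f a) := by
  refine ⟨map_mem_hull f ha.1, ?_⟩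
  rintro p ⟨s, hs, -, -, h, -⟩
  exact (f.monotone (ha.2 hs)).trans h

theorem isGreatest_hull (f : X ↪o Q) {S : Set X} {a : X} (ha : IsGreatest S a) :
    IsGreatest (hull f S) (f a) := by
  refine ⟨map_mem_hull f ha.1, ?_⟩
  rintro p ⟨-, -, t, ht, -, h⟩
  exact h.trans (f.monotone (ha.2 ht))

theorem hull_pair (f : X ↪o Q) {x y : X} (h : x ≤ y) : hull f {x, y} = Set.Icc (f x) (f y) := by
  refine Set.Subset.antisymm ?_ fun p hp => ⟨x, by simp, y, by simp, hp.1, hp.2⟩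
  have hf := f.monotone h
  exact hull_subset_iff.2 (Set.pair_subset ⟨le_rfl, hf⟩ ⟨hf, le_rfl⟩)

theorem hull_singleton (f : X ↪o Q) (x : X) : hull f {x} = {f x} := by
  simpa using hull_pair f (le_refl x)

section HullModule

variable (f : X ↪o Q) (S : Set X)

theorem restrict_map_injective_out_of_hull (Z : PMod k Q) (φ ψ : intervalModule k (hull f S) ⟶ Z)
    (h : (restrict k f).map φ = (restrict k f).map ψ) : φ = ψ := by
  refine interval_hom_ext_of_coinitial (A := f '' S) ?_ ?_
  · rintro p ⟨s, hs, -, -, hsp, -⟩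
    exact ⟨f s, Set.mem_image_of_mem f hs, map_mem_hull f hs, hsp⟩
  · rintro _ ⟨s, -, rfl⟩
    exact congrArg (fun χ => component χ s) h

theorem restrict_map_injective_into_hull (Z : PMod k Q) (φ ψ : Z ⟶ intervalModule k (hull f S))
    (h : (restrict k f).map φ = (restrict k f).map ψ) : φ = ψ := by
  refine interval_hom_ext_of_cofinal (A := f '' S) ?_ ?_
  · rintro p ⟨-, -, t, ht, -, hpt⟩
    exact ⟨f t, Set.mem_image_of_mem f ht, map_mem_hull f ht, hpt⟩
  · rintro _ ⟨s, -, rfl⟩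
    exact congrArg (fun χ => component χ s) h

theorem indecomposable_hull [S.OrdConnected] (hS : Indecomposable (intervalModule k S)) :
    Indecomposable (intervalModule k (hull f S)) := by
  have hS' := indecomposable_of_iso (restrictInterval f (preimage_hull f S)) hS
  refine indecomposable_of_functor (restrict k f) hS' fun e he => ?_
  exact restrict_map_injective_out_of_hull f S _ e 0 (he.trans (Functor.map_zero _ _ _).symm)

theorem nonempty_Theta_iso_hull [Finite X] [S.OrdConnected] {U : PMod k X}
    (e : U ≅ intervalModule k S) : Nonempty (Theta f U ≅ intervalModule k (hull f S)) :=
  (nonempty_iso_Theta (e ≪≫ (restrictInterval f (preimage_hull f S)).symm)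
    (restrict_map_injective_out_of_hull f S) (restrict_map_injective_into_hull f S)).map Iso.symm

end HullModule

end IntermediateExtension

/-! ### Multiplicities from ranks -/

section RankFamily

variable {k : Type v} [Field k] {X : Type w} [PartialOrder X] {𝒮 : Set (Set X)}
  [∀ S : 𝒮, S.1.OrdConnected]

open Classical in
/-- A family of additive invariants of `X`-modules, indexed by a set `𝒮` of order-convex subsets,
from which multiplicities can be computed by Möbius inversion: `r S` takes the value one on `𝕀_T` if
`S ⊆ T` and zero otherwise, and the modules `𝕀_S` are all the indecomposable modules. -/
structure IsRankFamily (r : 𝒮 → PMod k X → ℕ) : Prop where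
  additive (S : 𝒮) : IsAdditiveInvariant (r S)
  interval (S : 𝒮) (T : Set X) [T.OrdConnected] :
    r S (intervalModule k T) = if S.1 ⊆ T then 1 else 0
  indecomposable (S : 𝒮) : Indecomposable (intervalModule k S.1)
  exists_retract (N : PMod k X) (hN : ¬IsZero N) :
    ∃ S : 𝒮, Nonempty (Retract (intervalModule k S.1) N)

namespace IsRankFamily

variable {r : 𝒮 → PMod k X → ℕ} (h : IsRankFamily r)
include h

theorem exists_iso_interval {V : PMod k X} (hV : Indecomposable V) :
    ∃ S : 𝒮, Nonempty (V ≅ intervalModule k S.1) := by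
  obtain ⟨S, ⟨ρ⟩⟩ := h.exists_retract V hV.1
  obtain ⟨Z, ⟨e⟩⟩ := nonempty_iso_biprod_of_retract ρ
  have hZ : IsZero Z := (hV.2 _ _ e).resolve_left (h.indecomposable S).1
  exact ⟨S, ⟨e ≪≫ (isoBiprodZero hZ).symm⟩⟩

theorem exists_decomposition [Finite X] (N : PMod k X) :
    ∃ (n : ℕ) (V : Fin n → PMod k X), IsDecomposition N V := by
  have := Fintype.ofFinite X
  induction hd : ∑ x, Module.finrank k (N.obj x) using Nat.strong_induction_on generalizing N with
  | _ d ih =>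
  by_cases hN : IsZero N
  · refine ⟨0, Fin.elim0, fun i => i.elim0, ⟨hN.iso ((IsZero.iff_id_eq_zero _).2 ?_)⟩⟩
    exact biproduct.hom_ext _ _ fun i => i.elim0
  · obtain ⟨S, ⟨ρ⟩⟩ := h.exists_retract N hN
    obtain ⟨Z, ⟨e⟩⟩ := nonempty_iso_biprod_of_retract ρ
    have hdim := isAdditiveInvariant_totalDim (k := k) (Q := X)
    have hlt : ∑ x, Module.finrank k (Z.obj x) < d := by
      rw [← hd, hdim.iso e, hdim.biprod]
      exact Nat.lt_add_of_pos_left (totalDim_pos (h.indecomposable S).1)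
    obtain ⟨n, V, hV, ⟨e'⟩⟩ := ih _ hlt Z rfl
    exact ⟨n + 1, Fin.cons (intervalModule k S.1) V, Fin.cases (h.indecomposable S) hV,
      ⟨e ≪≫ biprod.mapIso (Iso.refl _) e' ≪≫
        (biproductFinSucc (Fin.cons (intervalModule k S.1) V : Fin (n + 1) → PMod k X)).symm⟩⟩

open Classical in
theorem zetaEquiv_symm_rank [Fintype 𝒮] {N U : PMod k X} {S : 𝒮}
    (hU : Nonempty (U ≅ intervalModule k S.1)) {n : ℕ} {V : Fin n → PMod k X}
    (hV : IsDecomposition N V) :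
    (zetaEquiv ℤ 𝒮).symm (fun S' => (r S' N : ℤ)) S =
      Nat.card {i : Fin n // Nonempty (V i ≅ U)} := by
  obtain ⟨hV, ⟨φ⟩⟩ := hV
  choose σ e using fun i => h.exists_iso_interval (hV i)
  have hr : (fun S' => (r S' N : ℤ)) = zetaEquiv ℤ 𝒮 (∑ i, Pi.single (σ i) 1) := by
    funext S'
    rw [(h.additive S').iso φ, (h.additive S').biproduct, map_sum, Finset.sum_apply, Nat.cast_sum]
    refine Finset.sum_congr rfl fun i _ => ?_
    obtain ⟨e⟩ := e i
    rw [(h.additive S').iso e, h.interval, zetaEquiv_apply]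
    simp only [Pi.single_apply]
    rw [Finset.sum_eq_single (σ i) (fun S _ hS => by rw [if_neg hS, ite_self]) (by simp)]
    simp
  have hσ (i : Fin n) : Nonempty (V i ≅ U) ↔ S = σ i := by
    obtain ⟨e⟩ := e i
    obtain ⟨u⟩ := hU
    rw [← Subtype.coe_inj, ← nonempty_interval_iso_iff (k := k)]
    exact ⟨fun ⟨φ⟩ => ⟨u.symm ≪≫ φ.symm ≪≫ e⟩, fun ⟨φ⟩ => ⟨e ≪≫ φ.symm ≪≫ u.symm⟩⟩
  rw [hr, LinearEquiv.symm_apply_apply, Finset.sum_apply, Nat.card_eq_fintype_card,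
    Fintype.card_subtype, Finset.natCast_card_filter]
  simp only [hσ, Pi.single_apply]

theorem exists_isMultiplicity [Finite X] [Fintype 𝒮] (N : PMod k X) {U : PMod k X} {S : 𝒮}
    (hU : Nonempty (U ≅ intervalModule k S.1)) :
    ∃ m : ℕ, IsMultiplicity U N m ∧
      (zetaEquiv ℤ 𝒮).symm (fun S' => (r S' N : ℤ)) S = m := by
  obtain ⟨n, V, hV⟩ := h.exists_decomposition N
  refine ⟨_, ⟨⟨n, V, hV⟩, fun n' V' hV' => ?_⟩, h.zetaEquiv_symm_rank hU hV⟩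
  exact_mod_cast (h.zetaEquiv_symm_rank hU hV').symm.trans (h.zetaEquiv_symm_rank hU hV)

theorem exists_equiv_of_isIndRepresentatives {I : Set (PMod k X)}
    (hI : IsIndRepresentatives (PMod k X) I) :
    ∃ τ : I ≃ 𝒮, ∀ U, Nonempty (U.1 ≅ intervalModule k (τ U).1) := by
  choose τ hτ using fun U : I => h.exists_iso_interval (hI.1 U.1 U.2)
  refine ⟨.ofBijective τ ⟨fun U V hUV => Subtype.ext ?_, fun S => ?_⟩, hτ⟩
  · obtain ⟨e⟩ := hτ U
    obtain ⟨e'⟩ := hτ V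
    rw [← hUV] at e'
    exact (hI.2 U.1 (hI.1 U.1 U.2)).unique ⟨U.2, ⟨Iso.refl _⟩⟩ ⟨V.2, ⟨e ≪≫ e'.symm⟩⟩
  · obtain ⟨U, ⟨hU, ⟨e⟩⟩, -⟩ := hI.2 _ (h.indecomposable S)
    obtain ⟨e'⟩ := hτ ⟨U, hU⟩
    exact ⟨⟨U, hU⟩, Subtype.ext ((nonempty_interval_iso_iff (k := k)).1 ⟨e ≪≫ e'⟩).symm⟩

end IsRankFamily

end RankFamily

section Hulls

variable {k : Type v} [Field k] {X : Type w} [PartialOrder X] {P : Type u} [PartialOrder P]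
  {𝒮 : Set (Set X)} {E : Set (X ↪o P)}

/-- The order-convex hulls of the images of the subsets in `𝒮` under the embeddings in `E`. -/
def hulls (E : Set (X ↪o P)) (𝒮 : Set (Set X)) : Set (Set P) := Set.image2 hull E 𝒮

instance (T : hulls E 𝒮) : T.1.OrdConnected := by
  obtain ⟨_, f, -, S, -, rfl⟩ := T
  infer_instance

variable [∀ S : 𝒮, S.1.OrdConnected] {r : 𝒮 → PMod k X → ℕ} {I : Set (PMod k X)}

namespace IsRankFamily

variable (h : IsRankFamily r)
include h

/-- The homomorphism sending the class of `M` to the ranks of the restriction of `M` along `f`. -/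
def rankHom (f : X ↪o P) : K0sp (PMod k P) →+ (𝒮 → ℤ) :=
  K0sp.lift (fun M S => (r S ((restrict k f).obj M) : ℤ)) <| .pi fun S =>
    ((h.additive S).comp_functor (restrict k f)).comp_addMonoidHom (Nat.castAddMonoidHom ℤ)

theorem exists_isMultInvariant [Finite X] (hI : IsIndRepresentatives (PMod k X) I)
    (E : Set (X ↪o P)) : ∃ Ψ : K0sp (PMod k P) →+ (E × I → ℤ),
      IsMultInvariant E I Ψ ∧ ∀ x, Ψ x = 0 ↔ ∀ f ∈ E, h.rankHom f x = 0 := by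
  have := Fintype.ofFinite 𝒮
  obtain ⟨τ, hτ⟩ := h.exists_equiv_of_isIndRepresentatives hI
  let z := zetaEquiv ℤ 𝒮
  let Ψ : K0sp (PMod k P) →+ (E × I → ℤ) := AddMonoidHom.pi fun p =>
    (Pi.evalAddMonoidHom _ (τ p.2)).comp (z.symm.toLinearMap.toAddMonoidHom.comp (h.rankHom p.1.1))
  have hΨ (x : K0sp (PMod k P)) (f : E) (U : I) : Ψ x (f, U) = z.symm (h.rankHom f.1 x) (τ U) := rfl
  refine ⟨Ψ, fun M f U => ?_, fun x => ⟨fun hx f hf => ?_, fun hx => funext fun p => ?_⟩⟩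
  · obtain ⟨m, hm, hm'⟩ := h.exists_isMultiplicity ((restrict k f.1).obj M) (hτ U)
    exact ⟨m, hm, by rw [hΨ, rankHom, K0sp.lift_cls, hm']⟩
  · refine z.symm.map_eq_zero_iff.1 (funext fun S => ?_)
    simpa [hΨ] using congrFun hx (⟨f, hf⟩, τ.symm S)
  · rw [hΨ, hx p.1.1 p.1.2, map_zero, Pi.zero_apply, Pi.zero_apply]

theorem exists_iso_hull_iff [Finite X] (hI : IsIndRepresentatives (PMod k X) I) {N : PMod k P} :
    (∃ R ∈ intermediateExtensions E I, Nonempty (N ≅ R)) ↔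
      ∃ T : hulls E 𝒮, Nonempty (N ≅ intervalModule k T.1) := by
  obtain ⟨τ, hτ⟩ := h.exists_equiv_of_isIndRepresentatives hI
  constructor
  · rintro ⟨_, ⟨f, hf, U, hU, rfl⟩, ⟨e⟩⟩
    obtain ⟨e'⟩ := nonempty_Theta_iso_hull f _ (hτ ⟨U, hU⟩).some
    exact ⟨⟨_, f, hf, _, (τ ⟨U, hU⟩).2, rfl⟩, ⟨e ≪≫ e'⟩⟩
  · rintro ⟨⟨_, f, hf, S, hS, rfl⟩, ⟨e⟩⟩
    obtain ⟨U, hUS⟩ := τ.surjective ⟨S, hS⟩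
    obtain ⟨e'⟩ := nonempty_Theta_iso_hull f _ (hUS ▸ hτ U).some
    exact ⟨_, ⟨f, hf, U.1, U.2, rfl⟩, ⟨e ≪≫ e'.symm⟩⟩

theorem range_cls_interval_hulls [Finite X] (hI : IsIndRepresentatives (PMod k X) I) :
    Set.range (fun T : hulls E 𝒮 => K0sp.cls (intervalModule k T.1)) =
      K0sp.cls '' intermediateExtensions E I := by
  ext x
  constructor
  · rintro ⟨T, rfl⟩
    obtain ⟨R, hR, ⟨φ⟩⟩ := (h.exists_iso_hull_iff hI).2 ⟨T, ⟨Iso.refl _⟩⟩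
    exact ⟨R, hR, (K0sp.cls_eq_of_iso φ).symm⟩
  · rintro ⟨R, hR, rfl⟩
    obtain ⟨T, ⟨φ⟩⟩ := (h.exists_iso_hull_iff hI).1 ⟨R, hR, ⟨Iso.refl R⟩⟩
    exact ⟨T, (K0sp.cls_eq_of_iso φ).symm⟩

theorem indecomposable_of_mem_intermediateExtensions [Finite X]
    (hI : IsIndRepresentatives (PMod k X) I) {N : PMod k P}
    (hN : N ∈ intermediateExtensions E I) : Indecomposable N := by
  obtain ⟨⟨_, f, _, S, hS, rfl⟩, ⟨φ⟩⟩ := (h.exists_iso_hull_iff hI).1 ⟨N, hN, ⟨Iso.refl N⟩⟩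
  exact indecomposable_of_iso φ
    (indecomposable_hull f (Subtype.val (⟨S, hS⟩ : 𝒮)) (h.indecomposable _))

section HullRank

variable {R : Set P → PMod k P → ℕ}
  (hR : ∀ f ∈ E, ∀ (S : 𝒮) M, r S ((restrict k f).obj M) = R (hull f S) M)
include hR

open Classical in
theorem rank_hull_interval (T T' : hulls E 𝒮) :
    R T (intervalModule k T'.1) = if T ≤ T' then 1 else 0 := by
  obtain ⟨_, f, hf, S, hS, rfl⟩ := T
  have hT' : (f ⁻¹' T'.1).OrdConnected :=
    Set.OrdConnected.preimage_mono (s := T'.1) inferInstance f.monotone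
  rw [← hR f hf ⟨S, hS⟩, (h.additive _).iso (restrictInterval f rfl), h.interval]
  exact if_congr hull_subset_iff.symm rfl rfl

theorem isAdditiveInvariant_rank_hull (T : hulls E 𝒮) : IsAdditiveInvariant (R T.1) := by
  obtain ⟨_, f, hf, S, hS, rfl⟩ := T
  rw [← funext (hR f hf ⟨S, hS⟩)]
  exact (h.additive _).comp_functor (restrict k f)

/-- The homomorphism sending the class of `M` to the ranks of `M` over the hulls. -/
def hullRankHom : K0sp (PMod k P) →+ (hulls E 𝒮 → ℤ) :=
  K0sp.lift (fun M T => (R T.1 M : ℤ)) <| .pi fun T =>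
    (h.isAdditiveInvariant_rank_hull hR T).comp_addMonoidHom (Nat.castAddMonoidHom ℤ)

theorem hullRankHom_eq_zero_iff (x : K0sp (PMod k P)) :
    h.hullRankHom hR x = 0 ↔ ∀ f ∈ E, h.rankHom f x = 0 := by
  have heq (f : X ↪o P) (hf : f ∈ E) (S : 𝒮) :
      h.hullRankHom hR x ⟨hull f S, f, hf, S, S.2, rfl⟩ = h.rankHom f x S := by
    let T : hulls E 𝒮 := ⟨hull f S, f, hf, S, S.2, rfl⟩
    refine DFunLike.congr_fun (K0sp.hom_ext
      (Φ := (Pi.evalAddMonoidHom (fun _ => ℤ) T).comp (h.hullRankHom hR))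
      (Ψ := (Pi.evalAddMonoidHom (fun _ => ℤ) S).comp (h.rankHom f)) fun M => ?_) x
    simp only [AddMonoidHom.comp_apply, Pi.evalAddMonoidHom_apply, hullRankHom, rankHom,
      K0sp.lift_cls, hR f hf S, T]
  refine ⟨fun hx f hf => funext fun S => ?_, fun hx => funext ?_⟩
  · rw [← heq f hf, hx, Pi.zero_apply, Pi.zero_apply]
  · rintro ⟨_, f, hf, S, hS, rfl⟩
    rw [heq f hf ⟨S, hS⟩, hx f hf, Pi.zero_apply, Pi.zero_apply]

theorem exists_isBasisOfInvariant [Finite X] (hE : E.Finite)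
    (hI : IsIndRepresentatives (PMod k X) I) : ∃ Ψ : K0sp (PMod k P) →+ (E × I → ℤ),
      IsMultInvariant E I Ψ ∧ IsBasisOfInvariant Ψ (intermediateExtensions E I) := by
  classical
  have : Finite (hulls E 𝒮) := hE.image2 hull 𝒮.toFinite
  obtain ⟨Ψ, hΨ, hker⟩ := h.exists_isMultInvariant hI E
  have hker : LinearMap.ker Ψ.toIntLinearMap =
      LinearMap.ker (h.hullRankHom hR).toIntLinearMap :=
    Submodule.ext fun x => (hker x).trans (h.hullRankHom_eq_zero_iff hR x).symm
  have hzeta (T T' : hulls E 𝒮) : (h.hullRankHom hR).toIntLinearMap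
      (K0sp.cls (intervalModule k T'.1)) T = if T ≤ T' then 1 else 0 := by
    simp [hullRankHom, K0sp.lift_cls, h.rank_hull_interval hR]
  have hrange := h.range_cls_interval_hulls (E := E) hI
  refine ⟨Ψ, hΨ, .of_isCompl (hrange ▸ Set.finite_range _)
    (fun N => h.indecomposable_of_mem_intermediateExtensions hI) ?_ ?_⟩
  · rw [← hrange]
    exact (linearIndependent_of_eq_zeta hzeta).linearIndepOn_id
  · rw [← hrange, hker]
    exact isCompl_span_ker_of_eq_zeta hzeta

end HullRank

end IsRankFamily

end Hulls

/-! ### Ranks over subsets with an extremal element -/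

section Ranks

variable {k : Type v} [Field k] {Q : Type u} [PartialOrder Q] {M N : PMod k Q} {a : Q} {S : Set Q}

/-- The sum of the kernels of the structure maps from `a` to the points of `S` above it. -/
def kernelSum (M : PMod k Q) (a : Q) (S : Set Q) : Submodule k (M.obj a) :=
  ⨆ (b : Q) (h : a ≤ b) (_ : b ∈ S), LinearMap.ker (transition M h)

/-- The intersection of the images in `M.obj a` of the structure maps from the points of `S`
below `a`. -/
def imageInter (M : PMod k Q) (a : Q) (S : Set Q) : Submodule k (M.obj a) :=
  ⨅ (b : Q) (h : b ≤ a) (_ : b ∈ S), LinearMap.range (transition M h)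

theorem kernelSum_le_iff {K : Submodule k (M.obj a)} : kernelSum M a S ≤ K ↔
    ∀ b (h : a ≤ b), b ∈ S → LinearMap.ker (transition M h) ≤ K := by
  simp only [kernelSum, iSup_le_iff]

theorem le_imageInter_iff {K : Submodule k (M.obj a)} : K ≤ imageInter M a S ↔
    ∀ b (h : b ≤ a), b ∈ S → K ≤ LinearMap.range (transition M h) := by
  simp only [imageInter, le_iInf_iff]

theorem kernelSum_le_comap (φ : M ⟶ N) (a : Q) (S : Set Q) :
    kernelSum M a S ≤ (kernelSum N a S).comap (component φ a) := by
  refine kernelSum_le_iff.2 fun b h hb x hx => kernelSum_le_iff.1 le_rfl b h hb ?_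
  rw [LinearMap.mem_ker] at hx ⊢
  rw [← component_transition, hx, map_zero]

theorem imageInter_le_comap (φ : M ⟶ N) (a : Q) (S : Set Q) :
    imageInter M a S ≤ (imageInter N a S).comap (component φ a) := by
  refine Submodule.map_le_iff_le_comap.1 (le_imageInter_iff.2 fun b h hb => ?_)
  rintro _ ⟨x, hx, rfl⟩
  obtain ⟨y, rfl⟩ := le_imageInter_iff.1 le_rfl b h hb hx
  exact ⟨component φ b y, (component_transition φ h y).symm⟩

/-- The functor sending a module to its space at `a` modulo the kernels of the structure maps
to the points of `S`. -/
def kernelQuotient (k : Type v) [Field k] (a : Q) (S : Set Q) : PMod k Q ⥤ FGModuleCat.{v} k where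
  obj M := FGModuleCat.of k (M.obj a ⧸ kernelSum M a S)
  map φ := FGModuleCat.ofHom (Submodule.mapQ _ _ (component φ a) (kernelSum_le_comap φ a S))
  map_id _ := FGModuleCat.hom_ext (Submodule.linearMap_qext _ rfl)
  map_comp _ _ := FGModuleCat.hom_ext (Submodule.linearMap_qext _ rfl)

instance (a : Q) (S : Set Q) : (kernelQuotient k a S).Additive where
  map_add := FGModuleCat.hom_ext (Submodule.linearMap_qext _ rfl)

/-- The functor sending a module to the common part, in its space at `a`, of the images of the
structure maps from the points of `S`. -/
def imageFunctor (k : Type v) [Field k] (a : Q) (S : Set Q) : PMod k Q ⥤ FGModuleCat.{v} k where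
  obj M := FGModuleCat.of k (imageInter M a S)
  map φ := FGModuleCat.ofHom ((component φ a).restrict (imageInter_le_comap φ a S))

instance (a : Q) (S : Set Q) : (imageFunctor k a S).Additive where

open Classical in
/-- The rank over a subset `S` with a least element `a`: the dimension of `M.obj a` modulo the
kernels of its structure maps to the points of `S`. It is zero by convention if `S` has no least
element. -/
def leastRank (S : Set Q) (M : PMod k Q) : ℕ :=
  if h : ∃ a, IsLeast S a then Module.finrank k ((kernelQuotient k h.choose S).obj M) else 0

open Classical in
/-- The rank over a subset `S` with a greatest element `a`: the dimension of the intersection, in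
`M.obj a`, of the images of the points of `S`. It is zero by convention if `S` has no greatest
element. -/
def greatestRank (S : Set Q) (M : PMod k Q) : ℕ :=
  if h : ∃ a, IsGreatest S a then Module.finrank k ((imageFunctor k h.choose S).obj M) else 0

theorem leastRank_eq (ha : IsLeast S a) (M : PMod k Q) :
    leastRank S M = Module.finrank k (M.obj a ⧸ kernelSum M a S) := by
  have h : ∃ a, IsLeast S a := ⟨a, ha⟩
  obtain rfl := h.choose_spec.unique ha
  exact dif_pos h

theorem greatestRank_eq (ha : IsGreatest S a) (M : PMod k Q) :
    greatestRank S M = Module.finrank k (imageInter M a S) := by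
  have h : ∃ a, IsGreatest S a := ⟨a, ha⟩
  obtain rfl := h.choose_spec.unique ha
  exact dif_pos h

theorem isAdditiveInvariant_leastRank (ha : IsLeast S a) :
    IsAdditiveInvariant (leastRank (k := k) S) := by
  rw [funext (leastRank_eq ha)]
  exact (isAdditiveInvariant_finrank k).comp_functor (kernelQuotient k a S)

theorem isAdditiveInvariant_greatestRank (ha : IsGreatest S a) :
    IsAdditiveInvariant (greatestRank (k := k) S) := by
  rw [funext (greatestRank_eq ha)]
  exact (isAdditiveInvariant_finrank k).comp_functor (imageFunctor k a S)

open Classical in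
theorem leastRank_interval (ha : IsLeast S a) (T : Set Q) [T.OrdConnected] :
    leastRank S (intervalModule k T) = if S ⊆ T then 1 else 0 := by
  rw [leastRank_eq ha]
  split_ifs with h
  · have : kernelSum (intervalModule k T) a S = ⊥ :=
      le_bot_iff.1 <| kernelSum_le_iff.2 fun b hab hb x hx => intervalCoord_injective <| by
        rw [← intervalCoord_transition hab (h hb), LinearMap.mem_ker.1 hx, map_zero, map_zero]
    rw [(Submodule.quotEquivOfEqBot _ this).finrank_eq, finrank_interval (h ha.1)]
  · obtain ⟨b, hb, hbT⟩ := Set.not_subset.1 h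
    have : kernelSum (intervalModule k T) a S = ⊤ := top_le_iff.1 <| le_trans
      (fun x _ => interval_eq_zero hbT _) (kernelSum_le_iff.1 le_rfl b (ha.2 hb) hb)
    have := Submodule.Quotient.subsingleton_iff.2 this
    exact Module.finrank_zero_of_subsingleton

open Classical in
theorem greatestRank_interval (ha : IsGreatest S a) (T : Set Q) [T.OrdConnected] :
    greatestRank S (intervalModule k T) = if S ⊆ T then 1 else 0 := by
  rw [greatestRank_eq ha]
  split_ifs with h
  · have : imageInter (intervalModule k T) a S = ⊤ :=
      top_le_iff.1 <| le_imageInter_iff.2 fun b hba hb x _ =>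
        ⟨intervalElt (h hb) (intervalCoord T a x), intervalCoord_injective <| by
          rw [intervalCoord_transition hba (h ha.1), intervalCoord_intervalElt]⟩
    rw [this, finrank_top, finrank_interval (h ha.1)]
  · obtain ⟨b, hb, hbT⟩ := Set.not_subset.1 h
    have : imageInter (intervalModule k T) a S = ⊥ := by
      refine le_bot_iff.1 ((le_imageInter_iff.1 le_rfl b (ha.2 hb) hb).trans ?_)
      rintro _ ⟨x, rfl⟩
      rw [interval_eq_zero hbT x, map_zero]
      exact zero_mem _
    rw [this, finrank_bot]

variable {X : Type w} [PartialOrder X]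

theorem leastRank_restrict (f : X ↪o Q) {S : Set X} {a : X} (ha : IsLeast S a) (M : PMod k Q) :
    leastRank S ((restrict k f).obj M) = leastRank (hull f S) M := by
  have heq : kernelSum ((restrict k f).obj M) a S = kernelSum M (f a) (hull f S) := by
    refine le_antisymm (kernelSum_le_iff.2 fun b h hb => ?_) (kernelSum_le_iff.2 ?_)
    · exact kernelSum_le_iff.1 (le_refl (kernelSum M (f a) (hull f S))) (f b) (f.monotone h)
        (map_mem_hull f hb)
    · rintro p h ⟨-, -, t, ht, -, hpt⟩ x hx
      refine kernelSum_le_iff.1 (le_refl (kernelSum ((restrict k f).obj M) a S)) t (ha.2 ht) ht ?_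
      change transition M (f.monotone (ha.2 ht)) x = 0
      rw [← transition_transition M h hpt, LinearMap.mem_ker.1 hx, map_zero]
  rw [leastRank_eq ha, leastRank_eq (isLeast_hull f ha), ← heq]
  rfl

theorem greatestRank_restrict (f : X ↪o Q) {S : Set X} {a : X} (ha : IsGreatest S a)
    (M : PMod k Q) : greatestRank S ((restrict k f).obj M) = greatestRank (hull f S) M := by
  have heq : imageInter ((restrict k f).obj M) a S = imageInter M (f a) (hull f S) := by
    refine le_antisymm (le_imageInter_iff (M := M).2 ?_)
      (le_imageInter_iff (M := (restrict k f).obj M).2 fun b h hb => ?_)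
    · rintro p h ⟨s, hs, -, -, hsp, -⟩ x hx
      obtain ⟨y, rfl⟩ := le_imageInter_iff.1 le_rfl s (ha.2 hs) hs hx
      exact ⟨transition M hsp y, transition_transition M hsp h y⟩
    · exact le_imageInter_iff.1 (le_refl (imageInter M (f a) (hull f S))) (f b) (f.monotone h)
        (map_mem_hull f hb)
  rw [greatestRank_eq ha, greatestRank_eq (isGreatest_hull f ha), ← heq]
  rfl

variable {𝒮 : Set (Set X)} [∀ S : 𝒮, S.1.OrdConnected]

theorem isRankFamily_leastRank (h𝒮 : ∀ S : 𝒮, ∃ a, IsLeast S.1 a)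
    (hretract : ∀ N : PMod k X, ¬IsZero N →
      ∃ S : 𝒮, Nonempty (Retract (intervalModule k S.1) N)) :
    IsRankFamily (k := k) fun S : 𝒮 => leastRank S.1 where
  additive S := isAdditiveInvariant_leastRank (h𝒮 S).choose_spec
  interval S T _ := leastRank_interval (h𝒮 S).choose_spec T
  indecomposable S := indecomposable_interval_of_isLeast (h𝒮 S).choose_spec
  exists_retract := hretract

theorem isRankFamily_greatestRank (h𝒮 : ∀ S : 𝒮, ∃ a, IsGreatest S.1 a)
    (hretract : ∀ N : PMod k X, ¬IsZero N →
      ∃ S : 𝒮, Nonempty (Retract (intervalModule k S.1) N)) :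
    IsRankFamily (k := k) fun S : 𝒮 => greatestRank S.1 where
  additive S := isAdditiveInvariant_greatestRank (h𝒮 S).choose_spec
  interval S T _ := greatestRank_interval (h𝒮 S).choose_spec T
  indecomposable S := indecomposable_interval_of_isGreatest (h𝒮 S).choose_spec
  exists_retract := hretract

end Ranks

section Retracts

variable {k : Type v} [Field k] {Q : Type u} [PartialOrder Q] {N : PMod k Q} {S : Set Q}
  [S.OrdConnected] {a : Q}

theorem nonempty_retract_of_isLeast (ha : IsLeast S a) {i : intervalModule k S ⟶ N}
    {r : N ⟶ intervalModule k S}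
    (h : intervalCoord S a (component r a (component i a (intervalElt ha.1 1))) = 1) :
    Nonempty (Retract (intervalModule k S) N) := by
  refine ⟨i, r, interval_hom_ext_of_isLeast ha (LinearMap.ext fun x => ?_)⟩
  rw [eq_smul_intervalElt ha.1 x, map_smul, map_smul, component_comp, component_id]
  exact congrArg _ (intervalCoord_injective h)

theorem nonempty_retract_of_isGreatest (ha : IsGreatest S a) {i : intervalModule k S ⟶ N}
    {r : N ⟶ intervalModule k S}
    (h : intervalCoord S a (component r a (component i a (intervalElt ha.1 1))) = 1) :
    Nonempty (Retract (intervalModule k S) N) := by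
  refine ⟨i, r, interval_hom_ext_of_isGreatest ha (LinearMap.ext fun x => ?_)⟩
  rw [eq_smul_intervalElt ha.1 x, map_smul, map_smul, component_comp, component_id]
  exact congrArg _ (intervalCoord_injective h)

theorem exists_functional_of_notMem {V : Type*} [AddCommGroup V] [Module k V] {K : Submodule k V}
    {v : V} (hv : v ∉ K) : ∃ ξ : V →ₗ[k] k, K ≤ LinearMap.ker ξ ∧ ξ v = 1 := by
  obtain ⟨φ, hφ, hK⟩ := Submodule.exists_le_ker_of_notMem hv
  refine ⟨(φ v)⁻¹ • φ, fun x hx => ?_, inv_mul_cancel₀ hφ⟩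
  rw [LinearMap.mem_ker, LinearMap.smul_apply, LinearMap.mem_ker.1 (hK hx), smul_zero]

theorem exists_comp_eq_of_ker_le {V W : Type*} [AddCommGroup V] [Module k V] [AddCommGroup W]
    [Module k W] {f : V →ₗ[k] W} {ξ : V →ₗ[k] k} (h : LinearMap.ker f ≤ LinearMap.ker ξ) :
    ∃ η : W →ₗ[k] k, η ∘ₗ f = ξ := by
  have : ξ ∈ LinearMap.range f.dualMap := by
    rw [LinearMap.range_dualMap_eq_dualAnnihilator_ker]
    exact (Submodule.mem_dualAnnihilator ξ).2 h
  exact this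

theorem nonempty_retract_singleton {v : N.obj a} {K : Submodule k (N.obj a)} (hv : v ∉ K)
    (hK : ∀ b (h : b < a), LinearMap.range (transition N h.le) ≤ K)
    (hv0 : ∀ b (h : a < b), transition N h.le v = 0) :
    Nonempty (Retract (intervalModule k {a}) N) := by
  obtain ⟨ξ, hξK, hξ⟩ := exists_functional_of_notMem hv
  obtain ⟨i, hi⟩ := exists_hom_of_isLeast (S := {a}) isLeast_singleton v
    fun b h hb => hv0 b (h.lt_of_ne (Ne.symm hb))
  obtain ⟨r, hr⟩ := exists_hom_of_isGreatest (S := {a}) isGreatest_singleton ξ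
    fun b h hb => LinearMap.range_le_ker_iff.1 ((hK b (h.lt_of_ne hb)).trans hξK)
  refine nonempty_retract_of_isLeast (S := {a}) isLeast_singleton (i := i) (r := r) ?_
  rw [hi, ← hξ, ← hr, LinearMap.comp_apply]

theorem nonempty_retract_of_bot_mem [OrderBot Q] (hS : ⊥ ∈ S)
    (hsurj : ∀ b ∈ S, Function.Surjective (transition N (bot_le : ⊥ ≤ b)))
    {v : N.obj ⊥} {K : Submodule k (N.obj ⊥)} (hv : v ∉ K)
    (hK : ∀ b ∈ S, LinearMap.ker (transition N (bot_le : ⊥ ≤ b)) ≤ K)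
    (hv0 : ∀ b ∉ S, transition N (bot_le : ⊥ ≤ b) v = 0) :
    Nonempty (Retract (intervalModule k S) N) := by
  have hbot : IsLeast S ⊥ := ⟨hS, fun _ _ => bot_le⟩
  obtain ⟨ξ, hξK, hξ⟩ := exists_functional_of_notMem hv
  have hη (b : Q) : ∃ η : N.obj b →ₗ[k] k,
      (b ∈ S → η ∘ₗ transition N (bot_le : ⊥ ≤ b) = ξ) ∧ (b ∉ S → η = 0) := by
    by_cases hb : b ∈ S
    · obtain ⟨η, hη⟩ := exists_comp_eq_of_ker_le ((hK b hb).trans hξK)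
      exact ⟨η, fun _ => hη, fun h => absurd hb h⟩
    · exact ⟨0, fun h => absurd h hb, fun _ => rfl⟩
  choose η hη hη0 using hη
  obtain ⟨i, hi⟩ := exists_hom_of_isLeast hbot v fun b _ => hv0 b
  let r : N ⟶ intervalModule k S := homToInterval S η (fun {b c} h hc => by
    have hb : b ∈ S := Set.OrdConnected.out ‹_› hS hc ⟨bot_le, h⟩
    refine (LinearMap.cancel_right (hsurj b hb)).1 ?_
    rw [hη b hb, LinearMap.comp_assoc, transition_comp_transition, hη c hc]) fun hb => hη0 _ hb
  refine nonempty_retract_of_isLeast hbot (i := i) (r := r) ?_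
  rw [hi, ← hξ, ← hη ⊥ hS, transition_self]
  rfl

theorem nonempty_retract_of_top_mem [OrderTop Q] (hS : ⊤ ∈ S)
    (hinj : ∀ b ∈ S, Function.Injective (transition N (le_top : b ≤ ⊤)))
    {v : N.obj ⊤} {K : Submodule k (N.obj ⊤)} (hv : v ∉ K)
    (hvS : ∀ b ∈ S, v ∈ LinearMap.range (transition N (le_top : b ≤ ⊤)))
    (hK : ∀ b ∉ S, LinearMap.range (transition N (le_top : b ≤ ⊤)) ≤ K) :
    Nonempty (Retract (intervalModule k S) N) := by
  have htop : IsGreatest S ⊤ := ⟨hS, fun _ _ => le_top⟩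
  obtain ⟨ξ, hξK, hξ⟩ := exists_functional_of_notMem hv
  have hw (b : Q) : ∃ w : N.obj b,
      (b ∈ S → transition N (le_top : b ≤ ⊤) w = v) ∧ (b ∉ S → w = 0) := by
    by_cases hb : b ∈ S
    · obtain ⟨w, hw⟩ := hvS b hb
      exact ⟨w, fun _ => hw, fun h => absurd hb h⟩
    · exact ⟨0, fun h => absurd h hb, fun _ => rfl⟩
  choose w hw hw0 using hw
  obtain ⟨r, hr⟩ := exists_hom_of_isGreatest htop ξ
    fun b _ hb => LinearMap.range_le_ker_iff.1 ((hK b hb).trans hξK)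
  let i : intervalModule k S ⟶ N := homOfInterval S w (fun {b c} h hb => by
    have hc : c ∈ S := Set.OrdConnected.out ‹_› hb hS ⟨h, le_top⟩
    apply hinj c hc
    rw [transition_transition, hw b hb, hw c hc]) fun hb => hw0 _ hb
  have hi : component i ⊤ (intervalElt hS 1) = v := by
    rw [component_homOfInterval hS, ← hw ⊤ hS, transition_self, LinearMap.id_apply]
  refine nonempty_retract_of_isGreatest htop (i := i) (r := r) ?_
  rw [hi, ← hξ, ← hr, LinearMap.comp_apply]

end Retracts

/-! ### Modules over the three-point posets -/

section ThreePointPosets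

variable {k : Type v} [Field k] {X : Type w} [PartialOrder X] {N : PMod k X}

/-- The points, the two-element chains and the whole of a poset. For `X'₃` and `X''₃` these are the
supports of the indecomposable modules. -/
def basicSubsets (X : Type w) [PartialOrder X] : Set (Set X) :=
  {S | (∃ a, S = {a}) ∨ (∃ a b, a < b ∧ S = {a, b}) ∨ S = Set.univ}

theorem singleton_mem_basicSubsets (a : X) : {a} ∈ basicSubsets X := Or.inl ⟨a, rfl⟩

theorem pair_mem_basicSubsets {a b : X} (h : a < b) : {a, b} ∈ basicSubsets X :=
  Or.inr (Or.inl ⟨a, b, h, rfl⟩)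

theorem univ_mem_basicSubsets : Set.univ ∈ basicSubsets X := Or.inr (Or.inr rfl)

theorem exists_isLeast_basicSubsets [OrderBot X] (S : basicSubsets X) : ∃ a, IsLeast S.1 a := by
  obtain ⟨_, ⟨a, rfl⟩ | ⟨a, b, h, rfl⟩ | rfl⟩ := S
  · exact ⟨a, isLeast_singleton⟩
  · exact ⟨a, by simp, by simp [h.le]⟩
  · exact ⟨⊥, isLeast_univ⟩

theorem exists_isGreatest_basicSubsets [OrderTop X] (S : basicSubsets X) :
    ∃ a, IsGreatest S.1 a := by
  obtain ⟨_, ⟨a, rfl⟩ | ⟨a, b, h, rfl⟩ | rfl⟩ := S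
  · exact ⟨a, isGreatest_singleton⟩
  · exact ⟨b, by simp, by simp [h.le]⟩
  · exact ⟨⊤, isGreatest_univ⟩

theorem nonempty_retract_singleton_of_not_surjective [OrderBot X] {a : X} (ha : IsAtom a)
    (hmax : IsMax a) (h : ¬Function.Surjective (transition N (bot_le : ⊥ ≤ a))) :
    Nonempty (Retract (intervalModule k {a}) N) := by
  obtain ⟨v, hv⟩ := not_forall.1 h
  refine nonempty_retract_singleton (v := v)
    (K := LinearMap.range (transition N (bot_le : ⊥ ≤ a))) hv (fun b hb => ?_)
    fun b hb => absurd hb hmax.not_lt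
  obtain rfl := ha.2 b hb
  exact le_rfl

theorem nonempty_retract_singleton_of_not_injective [OrderTop X] {a : X} (ha : IsCoatom a)
    (hmin : IsMin a) (h : ¬Function.Injective (transition N (le_top : a ≤ ⊤))) :
    Nonempty (Retract (intervalModule k {a}) N) := by
  rw [← LinearMap.ker_eq_bot, Submodule.eq_bot_iff] at h
  push Not at h
  obtain ⟨v, hv, hv0⟩ := h
  refine nonempty_retract_singleton (v := v) (K := ⊥) (by simpa using hv0)
    (fun b hb => absurd hb hmin.not_lt) fun b hb => ?_
  obtain rfl := ha.2 b hb
  exact hv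

end ThreePointPosets

namespace XPrime

variable {k : Type v} [Field k] {N : PMod k XPrime}

instance : OrderBot XPrime where
  bot := one
  bot_le _ := Or.inr rfl

instance (S : Set XPrime) : S.OrdConnected where
  out' := by
    rintro x hx y hy z ⟨rfl | rfl, rfl | rfl⟩ <;> assumption

theorem isAtom_of_ne {a : XPrime} (ha : a ≠ one) : IsAtom a := ⟨ha, fun _ h => h.2⟩

theorem isMax_of_ne {a : XPrime} (ha : a ≠ one) : IsMax a := fun _ h =>
  (h.resolve_right ha).ge

theorem hull_univ {P : Type u} [PartialOrder P] (f : XPrime ↪o P) :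
    hull f Set.univ = Set.Icc (f one) (f two) ∪ Set.Icc (f one) (f three) := by
  refine Set.Subset.antisymm (hull_subset_iff.2 fun x _ => ?_) ?_
  · have h (y : XPrime) : f one ≤ f y := f.monotone bot_le
    cases x
    exacts [Or.inl ⟨le_rfl, h two⟩, Or.inl ⟨h two, le_rfl⟩, Or.inr ⟨h three, le_rfl⟩]
  · rintro p (h | h)
    exacts [⟨one, trivial, two, trivial, h⟩, ⟨one, trivial, three, trivial, h⟩]

section Surjective

variable (hsurj : ∀ a, Function.Surjective (transition N (bot_le : ⊥ ≤ a)))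
include hsurj

theorem nonempty_retract_of_surjective {S : Set XPrime} (hS : one ∈ S) {v : N.obj ⊥}
    {K : Submodule k (N.obj ⊥)} (hv : v ∉ K)
    (hK : ∀ a ≠ one, a ∈ S → LinearMap.ker (transition N (bot_le : ⊥ ≤ a)) ≤ K)
    (hv0 : ∀ a ≠ one, a ∉ S → transition N (bot_le : ⊥ ≤ a) v = 0) :
    Nonempty (Retract (intervalModule k S) N) := by
  refine nonempty_retract_of_bot_mem hS (fun a _ => hsurj a) hv (fun a ha => ?_) fun a ha =>
    hv0 a (fun hone => ha (hone ▸ hS)) ha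
  obtain rfl | hone := eq_or_ne a one
  · change LinearMap.ker (transition N (le_refl one)) ≤ K
    rw [transition_self, LinearMap.ker_id]
    exact bot_le
  · exact hK a hone ha

theorem exists_retract_of_surjective (hN : ¬IsZero N) :
    ∃ S : basicSubsets XPrime, Nonempty (Retract (intervalModule k S.1) N) := by
  -- Up to isomorphism `N` is the space `N.obj ⊥` with its quotients by `K two` and `K three`. The
  -- summand is generated by a vector chosen according to the relative position of these subspaces.
  let K (a : XPrime) := LinearMap.ker (transition N (bot_le : ⊥ ≤ a))
  have hlt {a : XPrime} (ha : a ≠ one) : one < a := (isAtom_of_ne ha).bot_lt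
  by_cases h23 : K two ≤ K three; swap
  · obtain ⟨v, hv, hv'⟩ := SetLike.not_le_iff_exists.1 h23
    refine ⟨⟨_, pair_mem_basicSubsets (hlt (a := three) (by simp))⟩,
      nonempty_retract_of_surjective hsurj (by simp) hv' ?_ ?_⟩ <;>
    rintro (_ | _ | _) <;> simp_all [K]
  by_cases h32 : K three ≤ K two; swap
  · obtain ⟨v, hv, hv'⟩ := SetLike.not_le_iff_exists.1 h32
    refine ⟨⟨_, pair_mem_basicSubsets (hlt (a := two) (by simp))⟩,
      nonempty_retract_of_surjective hsurj (by simp) hv' ?_ ?_⟩ <;>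
    rintro (_ | _ | _) <;> simp_all [K]
  by_cases htop : K two = ⊤; swap
  · obtain ⟨v, -, hv⟩ := SetLike.exists_of_lt (lt_top_iff_ne_top.2 htop)
    refine ⟨⟨_, univ_mem_basicSubsets⟩, nonempty_retract_of_surjective hsurj trivial hv ?_
      fun a _ h => absurd trivial h⟩
    rintro (_ | _ | _) ha -
    exacts [absurd rfl ha, le_rfl, h32]
  obtain ⟨v, hv⟩ : ∃ v : N.obj ⊥, v ∉ (⊥ : Submodule k (N.obj ⊥)) := by
    by_contra! h
    refine hN (isZero_iff_forall.2 fun a x => ?_)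
    obtain ⟨y, rfl⟩ := hsurj a x
    rw [(Submodule.mem_bot k).1 (h y), map_zero]
  have hv2 : v ∈ K two := htop.ge trivial
  refine ⟨⟨_, singleton_mem_basicSubsets one⟩, nonempty_retract_of_surjective hsurj rfl hv
    (fun a ha h => absurd h ha) ?_⟩
  rintro (_ | _ | _) ha -
  exacts [absurd rfl ha, hv2, h23 hv2]

end Surjective

theorem exists_retract (hN : ¬IsZero N) :
    ∃ S : basicSubsets XPrime, Nonempty (Retract (intervalModule k S.1) N) := by
  by_cases h : ∃ a ≠ one, ¬Function.Surjective (transition N (bot_le : ⊥ ≤ a))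
  · obtain ⟨a, ha, h⟩ := h
    exact ⟨⟨_, singleton_mem_basicSubsets a⟩,
      nonempty_retract_singleton_of_not_surjective (isAtom_of_ne ha) (isMax_of_ne ha) h⟩
  · push Not at h
    refine exists_retract_of_surjective (fun a => ?_) hN
    obtain rfl | ha := eq_or_ne a one
    · change Function.Surjective (transition N (le_refl one))
      rw [transition_self]
      exact Function.surjective_id
    · exact h a ha

theorem isRankFamily : IsRankFamily (k := k) fun S : basicSubsets XPrime => leastRank S.1 :=
  isRankFamily_leastRank exists_isLeast_basicSubsets fun _ => exists_retract

end XPrime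

namespace XDoublePrime

variable {k : Type v} [Field k] {N : PMod k XDoublePrime}

instance : OrderTop XDoublePrime where
  top := three
  le_top _ := Or.inr rfl

instance (S : Set XDoublePrime) : S.OrdConnected where
  out' := by
    rintro x hx y hy z ⟨rfl | rfl, rfl | rfl⟩ <;> assumption

theorem isCoatom_of_ne {a : XDoublePrime} (ha : a ≠ three) : IsCoatom a :=
  ⟨ha, fun _ h => by_contra fun hb => h.1 (h.le.resolve_right hb)⟩

theorem isMin_of_ne {a : XDoublePrime} (ha : a ≠ three) : IsMin a := fun _ h =>
  (h.resolve_right ha).ge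

theorem hull_univ {P : Type u} [PartialOrder P] (f : XDoublePrime ↪o P) :
    hull f Set.univ = Set.Icc (f one) (f three) ∪ Set.Icc (f two) (f three) := by
  refine Set.Subset.antisymm (hull_subset_iff.2 fun x _ => ?_) ?_
  · have h (y : XDoublePrime) : f y ≤ f three := f.monotone le_top
    cases x
    exacts [Or.inl ⟨le_rfl, h one⟩, Or.inr ⟨le_rfl, h two⟩, Or.inl ⟨h one, le_rfl⟩]
  · rintro p (h | h)
    exacts [⟨one, trivial, three, trivial, h⟩, ⟨two, trivial, three, trivial, h⟩]

section Injective

variable (hinj : ∀ a, Function.Injective (transition N (le_top : a ≤ ⊤)))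
include hinj

theorem nonempty_retract_of_injective {S : Set XDoublePrime} (hS : three ∈ S) {v : N.obj ⊤}
    {K : Submodule k (N.obj ⊤)} (hv : v ∉ K)
    (hvS : ∀ a ≠ three, a ∈ S → v ∈ LinearMap.range (transition N (le_top : a ≤ ⊤)))
    (hK : ∀ a ≠ three, a ∉ S → LinearMap.range (transition N (le_top : a ≤ ⊤)) ≤ K) :
    Nonempty (Retract (intervalModule k S) N) := by
  refine nonempty_retract_of_top_mem hS (fun a _ => hinj a) hv (fun a ha => ?_) fun a ha =>
    hK a (fun hthree => ha (hthree ▸ hS)) ha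
  obtain rfl | hthree := eq_or_ne a three
  · change v ∈ LinearMap.range (transition N (le_refl three))
    rw [transition_self]
    exact ⟨v, rfl⟩
  · exact hvS a hthree ha

theorem exists_retract_of_injective (hN : ¬IsZero N) :
    ∃ S : basicSubsets XDoublePrime, Nonempty (Retract (intervalModule k S.1) N) := by
  -- Up to isomorphism `N` is the space `N.obj ⊤` with its subspaces `R one` and `R two`.
  let R (a : XDoublePrime) := LinearMap.range (transition N (le_top : a ≤ ⊤))
  have hlt {a : XDoublePrime} (ha : a ≠ three) : a < three := (isCoatom_of_ne ha).lt_top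
  by_cases h12 : R one ≤ R two; swap
  · obtain ⟨v, hv, hv'⟩ := SetLike.not_le_iff_exists.1 h12
    refine ⟨⟨_, pair_mem_basicSubsets (hlt (a := one) (by simp))⟩,
      nonempty_retract_of_injective hinj (by simp) hv' ?_ ?_⟩ <;>
    rintro (_ | _ | _) <;> simp_all [R]
  by_cases h21 : R two ≤ R one; swap
  · obtain ⟨v, hv, hv'⟩ := SetLike.not_le_iff_exists.1 h21
    refine ⟨⟨_, pair_mem_basicSubsets (hlt (a := two) (by simp))⟩,
      nonempty_retract_of_injective hinj (by simp) hv' ?_ ?_⟩ <;>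
    rintro (_ | _ | _) <;> simp_all [R]
  by_cases hbot : R one = ⊥; swap
  · obtain ⟨v, hv1, hv⟩ := SetLike.exists_of_lt (bot_lt_iff_ne_bot.2 hbot)
    refine ⟨⟨_, univ_mem_basicSubsets⟩, nonempty_retract_of_injective hinj trivial hv ?_
      fun a _ h => absurd trivial h⟩
    rintro (_ | _ | _) ha -
    exacts [hv1, h12 hv1, absurd rfl ha]
  obtain ⟨v, hv⟩ : ∃ v : N.obj ⊤, v ∉ (⊥ : Submodule k (N.obj ⊤)) := by
    by_contra! h
    refine hN (isZero_iff_forall.2 fun a x => hinj a ?_)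
    rw [(Submodule.mem_bot k).1 (h (transition N le_top x)), map_zero]
  refine ⟨⟨_, singleton_mem_basicSubsets three⟩, nonempty_retract_of_injective hinj rfl hv
    (fun a ha h => absurd h ha) ?_⟩
  rintro (_ | _ | _) ha -
  exacts [hbot.le, h21.trans hbot.le, absurd rfl ha]

end Injective

theorem exists_retract (hN : ¬IsZero N) :
    ∃ S : basicSubsets XDoublePrime, Nonempty (Retract (intervalModule k S.1) N) := by
  by_cases h : ∃ a ≠ three, ¬Function.Injective (transition N (le_top : a ≤ ⊤))
  · obtain ⟨a, ha, h⟩ := h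
    exact ⟨⟨_, singleton_mem_basicSubsets a⟩,
      nonempty_retract_singleton_of_not_injective (isCoatom_of_ne ha) (isMin_of_ne ha) h⟩
  · push Not at h
    refine exists_retract_of_injective (fun a => ?_) hN
    obtain rfl | ha := eq_or_ne a three
    · change Function.Injective (transition N (le_refl three))
      rw [transition_self]
      exact Function.injective_id
    · exact h a ha

theorem isRankFamily :
    IsRankFamily (k := k) fun S : basicSubsets XDoublePrime => greatestRank S.1 :=
  isRankFamily_greatestRank exists_isGreatest_basicSubsets fun _ => exists_retract

end XDoublePrime

section Covers

variable {k : Type v} [Field k] {P : Type u} [PartialOrder P] {X : Type w} [PartialOrder X]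
  {E : Set (X ↪o P)}

theorem exists_lt_or_gt [CategoryTheory.IsConnected P] [Nontrivial P] (p : P) :
    ∃ q, p < q ∨ q < p := by
  by_contra! h
  obtain ⟨q, hq⟩ := exists_ne p
  refine hq (induct_on_objects ({p} : Set P) rfl (fun {a b} f => ?_) q)
  have hab := leOfHom f
  constructor
  · rintro rfl
    exact (hab.eq_of_not_lt (h b).1).symm
  · rintro rfl
    exact hab.eq_of_not_lt (h a).2

theorem exists_mem_range_of_le [CategoryTheory.IsConnected P] [Nontrivial P]
    (hE : ∀ a b : P, a < b → ∃ f ∈ E, a ∈ Set.range f ∧ b ∈ Set.range f) (a b : P) (hab : a ≤ b) :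
    ∃ f ∈ E, a ∈ Set.range f ∧ b ∈ Set.range f := by
  obtain hlt | rfl := hab.lt_or_eq
  · exact hE a b hlt
  · obtain ⟨c, hc | hc⟩ := exists_lt_or_gt a
    · obtain ⟨f, hf, ha, -⟩ := hE a c hc
      exact ⟨f, hf, ha, ha⟩
    · obtain ⟨f, hf, -, ha⟩ := hE c a hc
      exact ⟨f, hf, ha, ha⟩

theorem nonempty_iso_interval_congr {N : PMod k P} {S T : Set P} [S.OrdConnected] [T.OrdConnected]
    (h : S = T) : Nonempty (N ≅ intervalModule k S) ↔ Nonempty (N ≅ intervalModule k T) := by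
  subst h
  rfl

variable (hE : ∀ a b : P, a ≤ b → ∃ f ∈ E, a ∈ Set.range f ∧ b ∈ Set.range f)
include hE

theorem mem_hulls_basicSubsets_iff {T : Set P} : T ∈ hulls E (basicSubsets X) ↔
    (∃ p, T = {p}) ∨ (∃ a b, a < b ∧ T = Set.Icc a b) ∨ ∃ f ∈ E, T = hull f Set.univ := by
  constructor
  · rintro ⟨f, hf, S, ⟨a, rfl⟩ | ⟨a, b, hab, rfl⟩ | rfl, rfl⟩
    · exact Or.inl ⟨f a, hull_singleton f a⟩
    · exact Or.inr (Or.inl ⟨f a, f b, f.strictMono hab, hull_pair f hab.le⟩)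
    · exact Or.inr (Or.inr ⟨f, hf, rfl⟩)
  · rintro (⟨p, rfl⟩ | ⟨a, b, hab, rfl⟩ | ⟨f, hf, rfl⟩)
    · obtain ⟨f, hf, ⟨x, rfl⟩, -⟩ := hE p p le_rfl
      exact ⟨f, hf, _, singleton_mem_basicSubsets x, hull_singleton f x⟩
    · obtain ⟨f, hf, ⟨x, rfl⟩, y, rfl⟩ := hE a b hab.le
      have hxy := f.lt_iff_lt.1 hab
      exact ⟨f, hf, _, pair_mem_basicSubsets hxy, hull_pair f hxy.le⟩
    · exact ⟨f, hf, _, univ_mem_basicSubsets, rfl⟩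

theorem exists_iso_interval_hulls_iff {N : PMod k P} :
    (∃ T : hulls E (basicSubsets X), Nonempty (N ≅ intervalModule k T.1)) ↔
      Simple N ∨ (∃ a b, a < b ∧ Nonempty (N ≅ intervalModule k (Set.Icc a b))) ∨
        ∃ f ∈ E, Nonempty (N ≅ intervalModule k (hull f Set.univ)) := by
  rw [simple_iff_exists_iso_interval]
  constructor
  · rintro ⟨⟨T, hT⟩, hN⟩
    obtain ⟨p, rfl⟩ | ⟨a, b, hab, rfl⟩ | ⟨f, hf, rfl⟩ := (mem_hulls_basicSubsets_iff hE).1 hT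
    exacts [Or.inl ⟨p, hN⟩, Or.inr (Or.inl ⟨a, b, hab, hN⟩), Or.inr (Or.inr ⟨f, hf, hN⟩)]
  · have hmem {T : Set P} := (mem_hulls_basicSubsets_iff hE (T := T)).2
    rintro (⟨p, hN⟩ | ⟨a, b, hab, hN⟩ | ⟨f, hf, hN⟩)
    exacts [⟨⟨_, hmem (Or.inl ⟨p, rfl⟩)⟩, hN⟩, ⟨⟨_, hmem (Or.inr (Or.inl ⟨a, b, hab, rfl⟩))⟩, hN⟩,
      ⟨⟨_, hmem (Or.inr (Or.inr ⟨f, hf, rfl⟩))⟩, hN⟩]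

end Covers

end PosetRep

end

theorem mainTheorem1_general (k : Type v) [Field k] (P : Type u) [PartialOrder P] :
    (∀ (E : Set (XPrime ↪o P)) (I : Set (PMod k XPrime)),
      IsIndRepresentatives (PMod k XPrime) I →
        (E.Finite → ∃ Ψ : K0sp (PMod k P) →+ (E × I → ℤ),
          IsMultInvariant E I Ψ ∧ IsBasisOfInvariant Ψ (intermediateExtensions E I)) ∧
        ((∀ a b : P, a ≤ b → ∃ f ∈ E, a ∈ Set.range f ∧ b ∈ Set.range f) → ∀ N : PMod k P,
          (∃ R ∈ intermediateExtensions E I, Nonempty (N ≅ R)) ↔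
            (Simple N ∨
              (∃ a b : P, a < b ∧ Nonempty (N ≅ intervalModule k (Set.Icc a b))) ∨
              (∃ f ∈ E, Nonempty (N ≅ intervalModule k
                (Set.Icc (f .one) (f .two) ∪ Set.Icc (f .one) (f .three))))))) ∧
    (∀ (E : Set (XDoublePrime ↪o P)) (I : Set (PMod k XDoublePrime)),
      IsIndRepresentatives (PMod k XDoublePrime) I →
        (E.Finite → ∃ Ψ : K0sp (PMod k P) →+ (E × I → ℤ),
          IsMultInvariant E I Ψ ∧ IsBasisOfInvariant Ψ (intermediateExtensions E I)) ∧
        ((∀ a b : P, a ≤ b → ∃ f ∈ E, a ∈ Set.range f ∧ b ∈ Set.range f) → ∀ N : PMod k P,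
          (∃ R ∈ intermediateExtensions E I, Nonempty (N ≅ R)) ↔
            (Simple N ∨
              (∃ a b : P, a < b ∧ Nonempty (N ≅ intervalModule k (Set.Icc a b))) ∨
              (∃ f ∈ E, Nonempty (N ≅ intervalModule k
                (Set.Icc (f .one) (f .three) ∪ Set.Icc (f .two) (f .three))))))) := by
  refine ⟨fun E I hI => ⟨fun hE => ?_, fun hE N => ?_⟩,
    fun E I hI => ⟨fun hE => ?_, fun hE N => ?_⟩⟩
  · exact XPrime.isRankFamily.exists_isBasisOfInvariant
      (fun f _ S M => leastRank_restrict f (exists_isLeast_basicSubsets S).choose_spec M)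
      hE hI
  · simp_rw [XPrime.isRankFamily.exists_iso_hull_iff hI, exists_iso_interval_hulls_iff hE,
      nonempty_iso_interval_congr (XPrime.hull_univ _)]
  · exact XDoublePrime.isRankFamily.exists_isBasisOfInvariant
      (fun f _ S M => greatestRank_restrict f (exists_isGreatest_basicSubsets S).choose_spec M)
      hE hI
  · simp_rw [XDoublePrime.isRankFamily.exists_iso_hull_iff hI, exists_iso_interval_hulls_iff hE,
      nonempty_iso_interval_congr (XDoublePrime.hull_univ _)]

theorem mainTheorem1 (k : Type v) [Field k] (P : Type u) [PartialOrder P] [Finite P]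
    [CategoryTheory.IsConnected P] :
    (∀ (E : Set (XPrime ↪o P)) (I : Set (PMod k XPrime)),
      IsEmbRepresentatives E → IsIndRepresentatives (PMod k XPrime) I →
      (∀ a b : P, a < b → ∃ f ∈ E, a ∈ Set.range f ∧ b ∈ Set.range f) →
        (∃ Ψ : K0sp (PMod k P) →+ (E × I → ℤ),
          IsMultInvariant E I Ψ ∧ IsBasisOfInvariant Ψ (intermediateExtensions E I)) ∧
        (Nontrivial P → ∀ N : PMod k P,
          (∃ R ∈ intermediateExtensions E I, Nonempty (N ≅ R)) ↔
            (Simple N ∨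
              (∃ a b : P, a < b ∧ Nonempty (N ≅ intervalModule k (Set.Icc a b))) ∨
              (∃ f ∈ E, Nonempty (N ≅ intervalModule k
                (Set.Icc (f .one) (f .two) ∪ Set.Icc (f .one) (f .three))))))) ∧
    (∀ (E : Set (XDoublePrime ↪o P)) (I : Set (PMod k XDoublePrime)),
      IsEmbRepresentatives E → IsIndRepresentatives (PMod k XDoublePrime) I →
      (∀ a b : P, a < b → ∃ f ∈ E, a ∈ Set.range f ∧ b ∈ Set.range f) →
        (∃ Ψ : K0sp (PMod k P) →+ (E × I → ℤ),
          IsMultInvariant E I Ψ ∧ IsBasisOfInvariant Ψ (intermediateExtensions E I)) ∧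
        (Nontrivial P → ∀ N : PMod k P,
          (∃ R ∈ intermediateExtensions E I, Nonempty (N ≅ R)) ↔
            (Simple N ∨
              (∃ a b : P, a < b ∧ Nonempty (N ≅ intervalModule k (Set.Icc a b))) ∨
              (∃ f ∈ E, Nonempty (N ≅ intervalModule k
                (Set.Icc (f .one) (f .three) ∪ Set.Icc (f .two) (f .three))))))) := by
  refine ⟨fun E I _ hI hE => ?_, fun E I _ hI hE => ?_⟩
  · have h := (mainTheorem1_general k P).1 E I hI
    have := FunLike.finite (XPrime ↪o P)
    exact ⟨h.1 E.toFinite, fun _ => h.2 (exists_mem_range_of_le hE)⟩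
  · have h := (mainTheorem1_general k P).2 E I hI
    have := FunLike.finite (XDoublePrime ↪o P)
    exact ⟨h.1 E.toFinite, fun _ => h.2 (exists_mem_range_of_le hE)⟩
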